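/- **Kelvin circulation theorems of order $2k+1$.** Let $d\ge 0$, let $J\subseteq\mathbb R$ be a nondegenerate interval with $0\in J$, and let $A$ be a real skew-symmetric $d\times d$ matrix, the constant angular velocity of a frame in $\mathbb E^d$ ($A=0$: inertial frame). Let $u(t,x)$, $t\in J$, $x\in\mathbb E^d$, be the smooth velocity relative to this frame of either (i) an ideal incompressible flow with smooth pressure $P$: $\nabla\cdot u=0$ and $\partial_t u+(u\cdot\nabla)u+2Au+A^2x=-\nabla P$; or (ii) a compressible barotropic flow with smooth density $\rho>0$ and pressure $p=f(\rho)$, $f$ smooth on $(0,\infty)$: $\partial_t\rho+\nabla\cdot(\rho u)=0$ and $\rho\,[\partial_t u+(u\cdot\nabla)u+2Au+A^2x]=-\nabla p$; in this case $P=\int dp/\rho$, that is, $P=h(\rho)$ with $h'(r)=f'(r)/r$. Time derivatives at an end point of $J$ are one-sided. Let $U=\sum_i u_i\,dx_i$, let $U_R=\sum_i (Ax)_i\,dx_i$ be the 1-form of the velocity $Ax$ of the frame, and put $$\theta=U+U_R,\qquad H^k=\theta\wedge(d\theta)^k,\qquad \Pi=P-u\cdot Ax-\tfrac12|Ax|^2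 .$$ In an inertial frame $\theta=U$ and $\Pi=P$. Here $d$ denotes the exterior derivative in $x$, $L_u$ the Lie derivative and $(d\theta)^0=1$. Then for every $k\ge 0$ and $t\in J$: 1. $d(H^k)=(d\theta)^{k+1}$. 2. $(\partial_t+L_u)H^k=-d\big[(\Pi-\tfrac12|u|^2)\,(d\theta)^k\big]$. That is, $(\partial_t+L_u)\theta=-d(\Pi-\tfrac12|u|^2)$ for $k=0$, and $(\partial_t+L_u)H^k=-d\big[(\Pi-\tfrac12|u|^2)\,d(H^{k-1})\big]$ for $k\ge1$. 3. $(\partial_t+L_u)(d\theta)^{k+1}=0$. 4. Let $\Phi:J\times\mathbb E^d\to\mathbb E^d$ be a smooth flow of $u$, that is, $\Phi_0=\mathrm{id}$ and $\partial_t\Phi_t(x)=u(t,\Phi_t(x))$. For every smooth singular $(2k+1)$-cycle $c_0$ with transported cycle $c_t=\Phi_t(c_0)$, $$\int_{c_t}H^k(t)=\int_{c_0}H^k(0).$$ 5. If $c_0$ is a smooth singular $(2k+1)$-chain and $c_t=\Phi_t(c_0)$ is the boundary of a smooth singular $(2k+2)$-chain $b$, then $\int_{c_t}H^k(t)=\int_b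 d(H^k(t))$. Chains are real linear combinations of smooth singular cubes $[0,1]^n\to\mathbb E^d$. Boundaries are compared modulo degenerate cubes, that is, cubes that do not depend on one of their variables; a cycle is a chain whose boundary vanishes in this sense. -/

import Mathlib

open Set
open scoped ContDiff Gradient

noncomputable section

namespace EulerForms

/-- Euclidean space `E^d`. -/
abbrev E (d : ℕ) : Type := EuclideanSpace ℝ (Fin d)

/-- Differential `n`-forms on `E^d`. The exterior derivative is Mathlib's `extDeriv`. -/
abbrev Form (d n : ℕ) : Type := E d → E d [⋀^Fin n]→L[ℝ] ℝ

/-! ### Exterior algebra and Lie derivative -/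

/-- The exterior product of alternating forms (the signed sum over shuffles), in degree
`p = m + n`; Mathlib's `AlternatingMap.domCoprod` with its indices renumbered. -/
def wedge {d m n p : ℕ} (h : m + n = p) (a : E d [⋀^Fin m]→L[ℝ] ℝ) (b : E d [⋀^Fin n]→L[ℝ] ℝ) :
    E d [⋀^Fin p]→L[ℝ] ℝ where
  __ := ((LinearMap.mul' ℝ ℝ).compAlternatingMap
      (a.toAlternatingMap.domCoprod b.toAlternatingMap)).domDomCongr
        (finSumFinEquiv.trans (finCongr h))
  cont := by
    change Continuous fun v : Fin p → E d => LinearMap.mul' ℝ ℝ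
      ((∑ σ, AlternatingMap.domCoprod.summand a.toAlternatingMap b.toAlternatingMap σ)
        fun i => v ((finSumFinEquiv.trans (finCongr h)) i))
    simp only [_root_.sum_apply, map_sum]
    refine continuous_finsetSum _ fun σ _ => ?_
    induction σ using Quotient.inductionOn' with | _ σ
    simp only [AlternatingMap.domCoprod.summand_mk'', _root_.smul_apply,
      MultilinearMap.domDomCongr_apply, MultilinearMap.domCoprod_apply]
    have key : Continuous fun v : Fin p → E d =>
        a (fun i => v ((finSumFinEquiv.trans (finCongr h)) (σ (Sum.inl i)))) *
          b (fun i => v ((finSumFinEquiv.trans (finCongr h)) (σ (Sum.inr i)))) := by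
      fun_prop
    rcases Int.units_eq_one_or (Equiv.Perm.sign σ) with hs | hs
    · simpa [hs] using key
    · simp only [hs, Units.neg_smul, one_smul, map_neg]
      exact continuous_neg.comp key

/-- The `1`-form `∑ vᵢ dxᵢ` of a vector field `v`. -/
def oneForm {d : ℕ} (v : E d → E d) : Form d 1 := fun x =>
  ContinuousAlternatingMap.ofSubsingleton ℝ (E d) ℝ (0 : Fin 1) (innerSL ℝ (v x))

/-- The exterior power `(dθ)^k` of the exterior derivative of a `1`-form `θ`. -/
def dPow {d : ℕ} (θ : Form d 1) : (k : ℕ) → Form d (2 * k)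
  | 0 => fun _ => ContinuousAlternatingMap.constOfIsEmpty ℝ (E d) (Fin 0) 1
  | k + 1 => fun x => wedge (Nat.mul_succ 2 k).symm (dPow θ k x) (extDeriv θ x)

/-- `H^k = θ ∧ (dθ)^k`, a form of degree `2k + 1`. -/
def H {d : ℕ} (θ : Form d 1) (k : ℕ) : Form d (2 * k + 1) := fun x =>
  wedge (Nat.add_comm 1 (2 * k)) (θ x) (dPow θ k x)

/-- The Lie derivative of an `n`-form along a vector field,
`(L_v α)(w₁, …, wₙ) = (D_v α)(w₁, …, wₙ) + ∑ᵢ α(w₁, …, Dv wᵢ, …, wₙ)`; the second summand is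
the derivative at the identity, in the direction `Dv`, of the pullback of `α x` by linear maps. -/
def lieDeriv {d n : ℕ} (v : E d → E d) (α : Form d n) : Form d n := fun x =>
  fderiv ℝ α x (v x) +
    (α x).fderivCompContinuousLinearMap (ContinuousLinearMap.id ℝ (E d)) (fderiv ℝ v x)

/-- `(∂_t + L_u) α` for a time-dependent form `α` and velocity field `u` on the time interval
`J` (one-sided time derivatives at end points of `J`). -/
def matDeriv {d n : ℕ} (J : Set ℝ) (u : ℝ → E d → E d) (α : ℝ → Form d n) (t : ℝ) : Form d n :=
  fun x => derivWithin (fun s => α s x) J t + lieDeriv (u t) (α t) x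

/-! ### Euler flows, in an inertial or a uniformly rotating frame -/

/-- The divergence of a vector field. -/
def divergence {d : ℕ} (v : E d → E d) (x : E d) : ℝ :=
  ∑ i, fderiv ℝ v x (EuclideanSpace.single i 1) i

/-- The acceleration of fluid particles, for the velocity `u` relative to a frame that rotates
uniformly with angular velocity the skew-symmetric map `A`: the material derivative
`∂_t u + (u · ∇) u`, the Coriolis term `2 A u` and the centrifugal term `A (A x)`.
For `A = 0` the frame is inertial. -/
def acceleration {d : ℕ} (J : Set ℝ) (A : E d →L[ℝ] E d) (u : ℝ → E d → E d) (t : ℝ) (x : E d) :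
    E d :=
  derivWithin (fun s => u s x) J t + fderiv ℝ (u t) x (u t x) + (2 : ℝ) • A (u t x) + A (A x)

/-- Smooth incompressible ideal flow of unit density with velocity `u` and pressure `P`. -/
structure IsIdealFlow {d : ℕ} (J : Set ℝ) (A : E d →L[ℝ] E d) (u : ℝ → E d → E d)
    (P : ℝ → E d → ℝ) : Prop where
  smooth_velocity : ContDiffOn ℝ ∞ (fun z : ℝ × E d => u z.1 z.2) (J ×ˢ univ)
  smooth_pressure : ContDiffOn ℝ ∞ (fun z : ℝ × E d => P z.1 z.2) (J ×ˢ univ)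
  incompressible : ∀ t ∈ J, ∀ x, divergence (u t) x = 0
  momentum : ∀ t ∈ J, ∀ x, acceleration J A u t x = -∇ (P t) x

/-- Smooth compressible barotropic flow with velocity `u`, density `ρ > 0`, pressure `p = f(ρ)`
and specific enthalpy `P = ∫ dp / ρ`, that is `P = h(ρ)` with `h' (r) = f' (r) / r`. -/
structure IsBarotropicFlow {d : ℕ} (J : Set ℝ) (A : E d →L[ℝ] E d) (u : ℝ → E d → E d)
    (ρ p P : ℝ → E d → ℝ) : Prop where
  smooth_velocity : ContDiffOn ℝ ∞ (fun z : ℝ × E d => u z.1 z.2) (J ×ˢ univ)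
  smooth_density : ContDiffOn ℝ ∞ (fun z : ℝ × E d => ρ z.1 z.2) (J ×ˢ univ)
  density_pos : ∀ t ∈ J, ∀ x, 0 < ρ t x
  state : ∃ f h : ℝ → ℝ, ContDiffOn ℝ ∞ f (Ioi 0) ∧
    (∀ r > 0, HasDerivAt h (deriv f r / r) r) ∧
    ∀ t ∈ J, ∀ x, p t x = f (ρ t x) ∧ P t x = h (ρ t x)
  continuity : ∀ t ∈ J, ∀ x,
    derivWithin (fun s => ρ s x) J t + divergence (fun y => ρ t y • u t y) x = 0
  momentum : ∀ t ∈ J, ∀ x, ρ t x • acceleration J A u t x = -∇ (p t) x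

/-- Ideal (incompressible) or barotropic Euler flow with velocity `u` relative to a frame of
angular velocity `A`; `P` is the pressure of the ideal fluid, respectively the enthalpy
`∫ dp / ρ` of the barotropic one. -/
def IsEulerFlow {d : ℕ} (J : Set ℝ) (A : E d →L[ℝ] E d) (u : ℝ → E d → E d)
    (P : ℝ → E d → ℝ) : Prop :=
  IsIdealFlow J A u P ∨ ∃ ρ p : ℝ → E d → ℝ, IsBarotropicFlow J A u ρ p P

/-! ### Smooth singular cubical chains -/

/-- The extension of a map on the cube `[0,1]^n` to `ℝ^n` by the coordinatewise projection;
only its values on `[0,1]^n` matter below. -/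
def cubeExtend {d n : ℕ} (σ : (Fin n → unitInterval) → E d) (y : Fin n → ℝ) : E d :=
  σ fun i => projIcc (0 : ℝ) 1 zero_le_one (y i)

/-- Smooth singular `n`-cubes in `E^d`. -/
def Cube (d n : ℕ) : Type :=
  {σ : (Fin n → unitInterval) → E d // ContDiffOn ℝ ∞ (cubeExtend σ) (Icc 0 1)}

/-- Smooth singular `n`-chains in `E^d`: formal linear combinations of smooth singular cubes. -/
abbrev Chain (d n : ℕ) : Type := Cube d n →₀ ℝ

/-- The face of a cube on which the `i`-th coordinate equals `ε`. -/
def Cube.face {d n : ℕ} (σ : Cube d (n + 1)) (i : Fin (n + 1)) (ε : unitInterval) : Cube d n where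
  val x := σ.1 (i.insertNth ε x)
  property := by
    have h : cubeExtend (fun x => σ.1 (i.insertNth ε x)) =
        cubeExtend σ.1 ∘ fun y : Fin n → ℝ => (i.insertNth (ε : ℝ) y : Fin (n + 1) → ℝ) := by
      funext y
      simp only [cubeExtend, Function.comp_apply]
      refine congrArg σ.1 (funext fun j => ?_)
      refine i.succAboveCases ?_ (fun j => ?_) j <;> simp
    rw [h]
    refine σ.2.comp (ContDiff.contDiffOn ?_) ?_
    · refine contDiff_pi.2 fun j => ?_
      refine i.succAboveCases ?_ (fun j => ?_) j
      · simpa using contDiff_const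
      · simpa using contDiff_apply ℝ ℝ j
    · intro y hy
      refine ⟨fun j => ?_, fun j => ?_⟩
      · refine i.succAboveCases ?_ (fun j => ?_) j
        · simpa using ε.2.1
        · simpa using hy.1 j
      · refine i.succAboveCases ?_ (fun j => ?_) j
        · simpa using ε.2.2
        · simpa using hy.2 j

/-- The image of a cube under a smooth map of `E^d`. -/
def Cube.map {d n : ℕ} (f : E d → E d) (hf : ContDiff ℝ ∞ f) (σ : Cube d n) : Cube d n where
  val x := f (σ.1 x)
  property := hf.comp_contDiffOn σ.2

/-- The boundary of a chain, with the usual orientation of the faces of a cube. -/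
def boundary {d n : ℕ} : Chain d (n + 1) →ₗ[ℝ] Chain d n :=
  Finsupp.linearCombination ℝ fun σ : Cube d (n + 1) =>
    ∑ i : Fin (n + 1), (-1 : ℝ) ^ (i : ℕ) •
      (Finsupp.single (σ.face i 1) 1 - Finsupp.single (σ.face i 0) 1)

/-- The degenerate chains: combinations of cubes that do not depend on one of their variables. -/
def degenerate (d n : ℕ) : Submodule ℝ (Chain d n) :=
  Submodule.span ℝ {c | ∃ σ : Cube d n, ∃ i : Fin n,
    (∀ x y : Fin n → unitInterval, (∀ j, j ≠ i → x j = y j) → σ.1 x = σ.1 y) ∧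
      c = Finsupp.single σ 1}

/-- Cycles: chains whose boundary vanishes modulo degenerate chains. -/
def IsCycle {d n : ℕ} (c : Chain d (n + 1)) : Prop := boundary c ∈ degenerate d n

/-- The integral of an `n`-form over a smooth singular `n`-cube. -/
def cubeIntegral {d n : ℕ} (α : Form d n) (σ : Cube d n) : ℝ :=
  ∫ y in Icc (0 : Fin n → ℝ) 1, α (cubeExtend σ.1 y) fun i =>
    fderivWithin ℝ (cubeExtend σ.1) (Icc 0 1) y (Pi.single i 1)

/-- The integral of an `n`-form over an `n`-chain. -/
def chainIntegral {d n : ℕ} (α : Form d n) (c : Chain d n) : ℝ :=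
  c.sum fun σ a => a * cubeIntegral α σ

/-! ### The flow and the conclusion -/

/-- `Φ` is the (smooth) flow on the time interval `J`, starting at time `0`, of the
time-dependent vector field `u`. -/
structure IsFlow {d : ℕ} (J : Set ℝ) (u : ℝ → E d → E d) (Φ : ℝ → E d → E d) : Prop where
  smooth : ContDiffOn ℝ ∞ (fun z : ℝ × E d => Φ z.1 z.2) (J ×ˢ univ)
  initial : ∀ x, Φ 0 x = x
  velocity : ∀ t ∈ J, ∀ x, HasDerivWithinAt (fun s => Φ s x) (u t (Φ t x)) J t

theorem IsFlow.contDiff {d : ℕ} {J : Set ℝ} {u Φ : ℝ → E d → E d} (h : IsFlow J u Φ)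
    {t : ℝ} (ht : t ∈ J) : ContDiff ℝ ∞ (Φ t) := by
  rw [← contDiffOn_univ]
  exact h.smooth.comp (f := fun x : E d => (t, x)) (by fun_prop) fun x _ => ⟨ht, mem_univ x⟩

/-- The chain `c_t = Φ_t(c)`. -/
def transport {d n : ℕ} {J : Set ℝ} {u Φ : ℝ → E d → E d} (h : IsFlow J u Φ) {t : ℝ}
    (ht : t ∈ J) (c : Chain d n) : Chain d n :=
  c.mapDomain (Cube.map (Φ t) (h.contDiff ht))

/-- The Kelvin theorems of all orders `2k + 1` for a time-dependent `1`-form `θ` that is carried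
by the velocity field `u` up to the differential of `q`. -/
structure KelvinTheorems {d : ℕ} (J : Set ℝ) (u : ℝ → E d → E d) (θ : ℝ → Form d 1)
    (q : ℝ → E d → ℝ) : Prop where
  /-- `d(H^k) = (dθ)^{k+1}` -/
  extDeriv_H : ∀ k, ∀ t ∈ J, ∀ x, extDeriv (H (θ t) k) x = dPow (θ t) (k + 1) x
  /-- `(∂_t + L_u) θ = -d q` -/
  matDeriv_H_zero : ∀ t ∈ J, ∀ x, matDeriv J u θ t x =
    -extDeriv (fun y => ContinuousAlternatingMap.constOfIsEmpty ℝ (E d) (Fin 0) (q t y)) x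
  /-- `(∂_t + L_u) H^k = -d[q (dθ)^k]` for `k ≥ 0` -/
  matDeriv_H : ∀ k, ∀ t ∈ J, ∀ x, matDeriv J u (fun s => H (θ s) k) t x =
    -extDeriv (fun y => q t y • dPow (θ t) k y) x
  /-- `(∂_t + L_u) H^k = -d[q d(H^{k-1})]` for `k ≥ 1` -/
  matDeriv_H_succ : ∀ k, ∀ t ∈ J, ∀ x, matDeriv J u (fun s => H (θ s) (k + 1)) t x =
    -extDeriv (fun y => q t y • extDeriv (H (θ t) k) y) x
  /-- `(∂_t + L_u) (dθ)^{k+1} = 0` -/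
  matDeriv_dPow : ∀ k, ∀ t ∈ J, ∀ x, matDeriv J u (fun s => dPow (θ s) (k + 1)) t x = 0
  /-- The integral of `H^k` over a `(2k+1)`-cycle transported by the flow is invariant. -/
  circulation : ∀ k, ∀ (Φ : ℝ → E d → E d) (hΦ : IsFlow J u Φ) (c : Chain d (2 * k + 1)),
    IsCycle c → ∀ (t : ℝ) (ht : t ∈ J),
      chainIntegral (H (θ t) k) (transport hΦ ht c) = chainIntegral (H (θ 0) k) c
  /-- If the transported chain bounds `b`, its circulation is the integral of `d(H^k)` over `b`. -/
  circulation_eq_flux : ∀ k, ∀ (Φ : ℝ → E d → E d) (hΦ : IsFlow J u Φ) (c : Chain d (2 * k + 1))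
    (t : ℝ) (ht : t ∈ J) (b : Chain d (2 * k + 1 + 1)),
      transport hΦ ht c - boundary b ∈ degenerate d (2 * k + 1) →
        chainIntegral (H (θ t) k) (transport hΦ ht c) = chainIntegral (extDeriv (H (θ t) k)) b

end EulerForms

end

open EulerForms

noncomputable section

namespace EulerForms

open Equiv (Perm permCongr)
open Equiv.Perm (sign)

/-! ### Antisymmetrization -/

/-! Write D = ∂_t + L_u and q = Π - |u|²/2. Everything follows from the single identity Dθ = -dq
together with two formal properties of D: it is a derivation of the exterior product
(`matDeriv_wedge`) and it commutes with d (`extDeriv_matDeriv`). They give D(dθ) = -ddq = 0, hence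
D(dθ)^k = 0, hence DH^k = -dq ∧ (dθ)^k. Since (dθ)^k is closed, this is -d[q (dθ)^k], and also dH^k
= (dθ)^{k+1}.

The identity itself is the Euler equation paired with a vector (`IsEulerFlow.matDeriv_oneForm`). In
both kinds of flow the acceleration is -dP, because dp/ρ = dP in the barotropic case. Skew-symmetry
of A turns the Coriolis and centrifugal terms, together with what the form of Ax contributes, into
the differentials of ⟨u, Ax⟩ and |Ax|²/2.

For the circulation, the time derivative of the pullback of a form by Φ_t is the pullback of its
material derivative (`hasDerivWithinAt_transported_density`). So the circulation of H^k changes at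
the rate given by the integral of an exact form over a transported cycle, which is zero by Stokes
(`chainIntegral_extDeriv`), degenerate cubes contributing nothing.

The exterior algebra is reduced to sums over the full symmetric group: m! n! (a ∧ b) is the
antisymmetrization of the plain product, so identities between exterior products become reindexings
of such sums. -/

/-- The sum of the signed permutations of a function of `p` vectors. -/
def asym {V : Type*} {p : ℕ} (F : (Fin p → V) → ℝ) (v : Fin p → V) : ℝ :=
  ∑ σ : Perm (Fin p), ((sign σ : ℤ) : ℝ) * F (v ∘ σ)

section asym

variable {V : Type*} {p : ℕ}

theorem sign_mul_self_real (π : Perm (Fin p)) :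
    ((sign π : ℤ) : ℝ) * ((sign π : ℤ) : ℝ) = 1 := by
  rcases Int.units_eq_one_or (sign π) with h | h <;> simp [h]

theorem asym_comp_perm (F : (Fin p → V) → ℝ) (π : Perm (Fin p)) (v : Fin p → V) :
    asym (fun w => F (w ∘ π)) v = ((sign π : ℤ) : ℝ) * asym F v := by
  unfold asym
  rw [Finset.mul_sum]
  refine Fintype.sum_equiv (Equiv.mulRight π) _ _ fun σ => ?_
  simp only [Equiv.coe_mulRight, Equiv.Perm.sign_mul, Units.val_mul, Int.cast_mul,
    Equiv.Perm.coe_mul,    Function.comp_assoc]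
  linear_combination (-((sign σ : ℤ) : ℝ) * F (v ∘ σ ∘ π)) * sign_mul_self_real π

theorem asym_sum {ι : Type*} (s : Finset ι) (F : ι → (Fin p → V) → ℝ) (v : Fin p → V) :
    asym (fun w => ∑ i ∈ s, F i w) v = ∑ i ∈ s, asym (F i) v := by
  simp only [asym, Finset.mul_sum]
  rw [Finset.sum_comm]

theorem asym_const_mul (c : ℝ) (F : (Fin p → V) → ℝ) (v : Fin p → V) :
    asym (fun w => c * F w) v = c * asym F v := by
  simp only [asym, Finset.mul_sum]
  exact Finset.sum_congr rfl fun σ _ => by ring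

/-- Antisymmetrization absorbs the antisymmetrization over a family of permutations. -/
theorem asym_sum_sign {m : ℕ} (e : Perm (Fin m) → Perm (Fin p)) (he : ∀ τ, sign (e τ) = sign τ)
    (F : (Fin p → V) → ℝ) (v : Fin p → V) :
    asym (fun w => ∑ τ : Perm (Fin m), ((sign τ : ℤ) : ℝ) * F (w ∘ e τ)) v =
      (m.factorial : ℝ) * asym F v := by
  rw [asym_sum]
  have : ∀ τ ∈ Finset.univ, asym (fun w => ((sign τ : ℤ) : ℝ) * F (w ∘ e τ)) v = asym F v := by
    intro τ _
    rw [asym_const_mul, asym_comp_perm, he, ← mul_assoc, sign_mul_self_real, one_mul]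
  rw [Finset.sum_congr rfl this]
  simp [Fintype.card_perm]

theorem asym_alternating {V : Type*} [NormedAddCommGroup V] [NormedSpace ℝ V]
    (a : V [⋀^Fin p]→L[ℝ] ℝ) (v : Fin p → V) : asym a v = (p.factorial : ℝ) * a v := by
  unfold asym
  have : ∀ σ ∈ Finset.univ, ((sign σ : ℤ) : ℝ) * a (v ∘ σ) = a v := by
    intro σ _
    have h := a.toAlternatingMap.map_perm v σ
    simp only [ContinuousAlternatingMap.coe_toAlternatingMap] at h
    rw [h, Units.smul_def, zsmul_eq_mul, ← mul_assoc, sign_mul_self_real, one_mul]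
  rw [Finset.sum_congr rfl this]
  simp [Fintype.card_perm]

end asym

/-! ### Exterior product and antisymmetrized derivative as sums over all permutations. -/

section wedge

variable {d m n p : ℕ}

/-- The indices of the first factor of an exterior product. -/
def inlIdx (h : m + n = p) (i : Fin m) : Fin p := Fin.cast h (Fin.castAdd n i)

/-- The indices of the second factor of an exterior product. -/
def inrIdx (h : m + n = p) (i : Fin n) : Fin p := Fin.cast h (Fin.natAdd m i)

/-- Each shuffle is a coset of the permutations preserving the two blocks, and all m! n! members of
a coset contribute equally because `a` and `b` are alternating. Multiplying by the factorials avoids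
choosing representatives. -/
theorem factorial_mul_wedge (h : m + n = p) (a : E d [⋀^Fin m]→L[ℝ] ℝ) (b : E d [⋀^Fin n]→L[ℝ] ℝ)
    (v : Fin p → E d) :
    ((m.factorial : ℝ) * n.factorial) * wedge h a b v =
      asym (fun w => a (w ∘ inlIdx h) * b (w ∘ inrIdx h)) v := by
  have key := congrArg (fun f => LinearMap.mul' ℝ ℝ
      (f (fun i => v ((finSumFinEquiv.trans (finCongr h)) i))))
    (MultilinearMap.domCoprod_alternization_eq a.toAlternatingMap b.toAlternatingMap)
  have hw : wedge h a b v = LinearMap.mul' ℝ ℝ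
      ((a.toAlternatingMap.domCoprod b.toAlternatingMap)
        (fun i => v ((finSumFinEquiv.trans (finCongr h)) i))) := rfl
  simp only [Fintype.card_fin] at key
  rw [hw]
  refine Eq.trans ?_ (key.symm.trans ?_)
  · rw [AlternatingMap.smul_apply, map_nsmul, nsmul_eq_mul]
    push_cast
    rfl
  · rw [MultilinearMap.alternatization_apply, map_sum]
    unfold asym
    refine Fintype.sum_equiv (permCongr (finSumFinEquiv.trans (finCongr h))) _ _ fun σ => ?_
    rw [Equiv.Perm.sign_permCongr, map_zsmul_unit, Units.smul_def, zsmul_eq_mul]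
    congr 1
    rw [MultilinearMap.domDomCongr_apply, MultilinearMap.domCoprod_apply, LinearMap.mul'_apply]
    change a _ * b _ = a _ * b _
    congr 2
    · funext i
      simp [inlIdx, Equiv.permCongr_apply]
    · funext i
      simp [inrIdx, Equiv.permCongr_apply]

theorem wedge_ext (h : m + n = p) {a : E d [⋀^Fin m]→L[ℝ] ℝ} {b : E d [⋀^Fin n]→L[ℝ] ℝ}
    {v : Fin p → E d} {x : ℝ}
    (hx : asym (fun w => a (w ∘ inlIdx h) * b (w ∘ inrIdx h)) v =
      ((m.factorial : ℝ) * n.factorial) * x) : wedge h a b v = x := by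
  rw [← factorial_mul_wedge h a b v] at hx
  exact mul_left_cancel₀ (by positivity) hx

/-- All m + 1 terms of the alternating sum have the same antisymmetrization: moving the
distinguished slot from 0 to `i` is a cycle of sign (-1)^i, which cancels the coefficient. The sum
is already alternating, so antisymmetrizing it multiplies it by (m + 1)!, and a factor m + 1 is
cancelled. -/
theorem factorial_mul_alternatizeUncurryFin {V : Type*} [NormedAddCommGroup V] [NormedSpace ℝ V]
    (f : V →L[ℝ] V [⋀^Fin m]→L[ℝ] ℝ) (v : Fin (m + 1) → V) :
    (m.factorial : ℝ) * ContinuousAlternatingMap.alternatizeUncurryFin f v =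
      asym (fun w => f (w 0) (w ∘ Fin.succ)) v := by
  have h1 := asym_alternating (ContinuousAlternatingMap.alternatizeUncurryFin f) v
  have h2 : ∀ i ∈ (Finset.univ : Finset (Fin (m + 1))), asym (fun w : Fin (m + 1) → V =>
      (-1 : ℝ) ^ (i : ℕ) * f (w i) (i.removeNth w)) v =
        asym (fun w => f (w 0) (w ∘ Fin.succ)) v := by
    intro i _
    have hi : (fun w : Fin (m + 1) → V => (-1 : ℝ) ^ (i : ℕ) * f (w i) (i.removeNth w)) =
        fun w => (-1 : ℝ) ^ (i : ℕ) * (fun w : Fin (m + 1) → V => f (w 0) (w ∘ Fin.succ))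
          -- This inverse cycle sends 0 to `i` and `j.succ` to `i.succAbove j`.
          (w ∘ ((i.cycleRange)⁻¹ : Perm (Fin (m + 1)))) := by
      funext w
      simp only [Function.comp_apply, Equiv.Perm.inv_def, Fin.cycleRange_symm_zero]
      congr 2
      funext j
      simp [Fin.removeNth, Fin.cycleRange_symm_succ]
    rw [hi, asym_const_mul,
      asym_comp_perm (fun w : Fin (m + 1) → V => f (w 0) (w ∘ Fin.succ)), Equiv.Perm.sign_inv,
      Fin.sign_cycleRange]
    push_cast
    rw [← mul_assoc, ← mul_pow]
    simp
  have h3 : asym (ContinuousAlternatingMap.alternatizeUncurryFin f) v =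
      ((m : ℝ) + 1) * asym (fun w => f (w 0) (w ∘ Fin.succ)) v := by
    have : ⇑(ContinuousAlternatingMap.alternatizeUncurryFin f) = fun w : Fin (m + 1) → V =>
        ∑ i : Fin (m + 1), (-1 : ℝ) ^ (i : ℕ) * f (w i) (i.removeNth w) := by
      funext w
      rw [ContinuousAlternatingMap.alternatizeUncurryFin_apply]
      simp
    rw [this, asym_sum, Finset.sum_congr rfl h2]
    simp
  rw [h3, Nat.factorial_succ] at h1
  push_cast at h1
  have : ((m : ℝ) + 1) ≠ 0 := by positivity
  exact mul_left_cancel₀ this (by linarith)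

/-! ### Extension of permutations -/

/-- This and the next lemma supply the families of permutations to which `asym_sum_sign` is applied.
-/
theorem exists_perm_extend_inl (h : m + n = p) (τ : Perm (Fin m)) : ∃ e : Perm (Fin p),
    sign e = sign τ ∧ e ∘ inlIdx h = inlIdx h ∘ τ ∧ e ∘ inrIdx h = inrIdx h := by
  refine ⟨permCongr (finSumFinEquiv.trans (finCongr h)) (Equiv.Perm.sumCongr τ 1), ?_, ?_, ?_⟩
  · simp [Equiv.Perm.sign_permCongr, Equiv.Perm.sign_sumCongr]
  · funext i; simp [inlIdx, Equiv.permCongr_apply]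
  · funext i; simp [inrIdx, Equiv.permCongr_apply]

theorem exists_perm_extend_succ (τ : Perm (Fin p)) : ∃ e : Perm (Fin (p + 1)),
    sign e = sign τ ∧ e 0 = 0 ∧ e ∘ Fin.succ = Fin.succ ∘ τ := by
  refine ⟨Equiv.Perm.decomposeFin.symm (0, τ), ?_, ?_, ?_⟩
  · simp
  · simp
  · funext i; simp

/-! ### Algebra of the exterior product -/

theorem wedge_add_left (h : m + n = p) (a a' : E d [⋀^Fin m]→L[ℝ] ℝ)
    (b : E d [⋀^Fin n]→L[ℝ] ℝ) : wedge h (a + a') b = wedge h a b + wedge h a' b := by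
  ext v
  refine wedge_ext h ?_
  rw [ContinuousAlternatingMap.add_apply, mul_add, factorial_mul_wedge, factorial_mul_wedge]
  simp only [asym, ← Finset.sum_add_distrib]
  exact Finset.sum_congr rfl fun σ _ => by rw [ContinuousAlternatingMap.add_apply]; ring

theorem wedge_add_right (h : m + n = p) (a : E d [⋀^Fin m]→L[ℝ] ℝ)
    (b b' : E d [⋀^Fin n]→L[ℝ] ℝ) : wedge h a (b + b') = wedge h a b + wedge h a b' := by
  ext v
  refine wedge_ext h ?_
  rw [ContinuousAlternatingMap.add_apply, mul_add, factorial_mul_wedge, factorial_mul_wedge]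
  simp only [asym, ← Finset.sum_add_distrib]
  exact Finset.sum_congr rfl fun σ _ => by rw [ContinuousAlternatingMap.add_apply]; ring

theorem wedge_smul_left (h : m + n = p) (c : ℝ) (a : E d [⋀^Fin m]→L[ℝ] ℝ)
    (b : E d [⋀^Fin n]→L[ℝ] ℝ) : wedge h (c • a) b = c • wedge h a b := by
  ext v
  refine wedge_ext h ?_
  rw [ContinuousAlternatingMap.smul_apply, smul_eq_mul, mul_left_comm, factorial_mul_wedge,
    ← asym_const_mul]
  simp [mul_assoc]

theorem wedge_smul_right (h : m + n = p) (c : ℝ) (a : E d [⋀^Fin m]→L[ℝ] ℝ)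
    (b : E d [⋀^Fin n]→L[ℝ] ℝ) : wedge h a (c • b) = c • wedge h a b := by
  ext v
  refine wedge_ext h ?_
  rw [ContinuousAlternatingMap.smul_apply, smul_eq_mul, mul_left_comm, factorial_mul_wedge,
    ← asym_const_mul]
  simp [mul_left_comm]

/-- A crude bound: p! terms of equal size, and division by m! n! ≥ 1 only helps. It serves to make
the product a continuous bilinear map, so that the calculus of bilinear maps applies. -/
theorem abs_wedge_apply_le (h : m + n = p) (a : E d [⋀^Fin m]→L[ℝ] ℝ)
    (b : E d [⋀^Fin n]→L[ℝ] ℝ) (v : Fin p → E d) :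
    ‖wedge h a b v‖ ≤ (p.factorial : ℝ) * ‖a‖ * ‖b‖ * ∏ i, ‖v i‖ := by
  have h1 : ‖asym (fun w => a (w ∘ inlIdx h) * b (w ∘ inrIdx h)) v‖ ≤
      (p.factorial : ℝ) * ‖a‖ * ‖b‖ * ∏ i, ‖v i‖ := by
    have hb : ∀ σ ∈ (Finset.univ : Finset (Perm (Fin p))), ‖((sign σ : ℤ) : ℝ) *
        (a ((v ∘ σ) ∘ inlIdx h) * b ((v ∘ σ) ∘ inrIdx h))‖ ≤ ‖a‖ * ‖b‖ * ∏ i, ‖v i‖ := by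
      intro σ _
      have hs : ‖((sign σ : ℤ) : ℝ)‖ = 1 := by
        rcases Int.units_eq_one_or (sign σ) with h | h <;> simp [h]
      have hprod : ∏ i, ‖v i‖ =
          (∏ i, ‖((v ∘ σ) ∘ inlIdx h) i‖) * ∏ i, ‖((v ∘ σ) ∘ inrIdx h) i‖ := by
        rw [← Equiv.prod_comp σ, ← Equiv.prod_comp (finSumFinEquiv.trans (finCongr h)),
          Fintype.prod_sum_type]
        simp [inlIdx, inrIdx]
      rw [norm_mul, norm_mul, hs, one_mul, hprod]
      calc _ ≤ (‖a‖ * ∏ i, ‖((v ∘ σ) ∘ inlIdx h) i‖) *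
            (‖b‖ * ∏ i, ‖((v ∘ σ) ∘ inrIdx h) i‖) :=
            mul_le_mul (a.le_opNorm _) (b.le_opNorm _) (norm_nonneg _) (by positivity)
        _ = _ := by ring
    refine (norm_sum_le_of_le _ hb).trans (le_of_eq ?_)
    simp [Fintype.card_perm, mul_assoc]
  rw [← factorial_mul_wedge, norm_mul] at h1
  refine le_trans ?_ h1
  refine le_mul_of_one_le_left (norm_nonneg _) ?_
  rw [Real.norm_of_nonneg (by positivity)]
  exact_mod_cast Nat.one_le_iff_ne_zero.2
    (Nat.mul_ne_zero (Nat.factorial_ne_zero m) (Nat.factorial_ne_zero n))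

/-- The exterior product as a continuous bilinear map. -/
def wedgeL (h : m + n = p) : (E d [⋀^Fin m]→L[ℝ] ℝ) →L[ℝ] (E d [⋀^Fin n]→L[ℝ] ℝ) →L[ℝ]
    (E d [⋀^Fin p]→L[ℝ] ℝ) :=
  LinearMap.mkContinuous₂
    (LinearMap.mk₂ ℝ (wedge h) (wedge_add_left h) (wedge_smul_left h) (wedge_add_right h)
      (fun c a b => wedge_smul_right h c a b)) (p.factorial : ℝ) fun a b =>
    ContinuousAlternatingMap.opNorm_le_bound _ (by positivity) (abs_wedge_apply_le h a b)

@[simp]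
theorem wedgeL_apply (h : m + n = p) (a : E d [⋀^Fin m]→L[ℝ] ℝ) (b : E d [⋀^Fin n]→L[ℝ] ℝ) :
    wedgeL h a b = wedge h a b := rfl

theorem wedge_compContinuousLinearMap (h : m + n = p) (a : E d [⋀^Fin m]→L[ℝ] ℝ)
    (b : E d [⋀^Fin n]→L[ℝ] ℝ) (L : E d →L[ℝ] E d) :
    (wedge h a b).compContinuousLinearMap L =
      wedge h (a.compContinuousLinearMap L) (b.compContinuousLinearMap L) := by
  ext v
  symm
  refine wedge_ext h ?_
  rw [ContinuousAlternatingMap.compContinuousLinearMap_apply, factorial_mul_wedge]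
  rfl

/-- Pullback by `M` is multiplicative for the exterior product; differentiating at `M = id` in the
direction `L` gives a Leibniz rule, by uniqueness of derivatives. -/
theorem wedge_fderivComp (h : m + n = p) (a : E d [⋀^Fin m]→L[ℝ] ℝ)
    (b : E d [⋀^Fin n]→L[ℝ] ℝ) (L : E d →L[ℝ] E d) :
    (wedge h a b).fderivCompContinuousLinearMap (ContinuousLinearMap.id ℝ (E d)) L =
      wedge h (a.fderivCompContinuousLinearMap (ContinuousLinearMap.id ℝ (E d)) L) b +
        wedge h a (b.fderivCompContinuousLinearMap (ContinuousLinearMap.id ℝ (E d)) L) := by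
  have hd : ∀ {q : ℕ} (c : E d [⋀^Fin q]→L[ℝ] ℝ),
      HasFDerivAt (fun M : E d →L[ℝ] E d => c.compContinuousLinearMap M)
        (c.fderivCompContinuousLinearMap (ContinuousLinearMap.id ℝ (E d)))
        (ContinuousLinearMap.id ℝ (E d)) := by
    intro q c
    have := (hasFDerivAt_const (𝕜 := ℝ) c (ContinuousLinearMap.id ℝ
      (E d))).continuousAlternatingMapCompContinuousLinearMap
      (hasFDerivAt_id (𝕜 := ℝ) (ContinuousLinearMap.id ℝ (E d)))
    convert! this using 1
    ext; simp
  have h1 := hd (wedge h a b)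
  have h2 := (wedgeL h).hasFDerivAt_of_bilinear (hd a) (hd b)
  have h3 : (fun M : E d →L[ℝ] E d => (wedge h a b).compContinuousLinearMap M) =
      fun M => wedgeL h (a.compContinuousLinearMap M) (b.compContinuousLinearMap M) := by
    funext M
    exact wedge_compContinuousLinearMap h a b M
  rw [h3] at h1
  have h4 := congrArg (fun T => T L) (h1.unique h2)
  have hid : ∀ {q : ℕ} (c : E d [⋀^Fin q]→L[ℝ] ℝ),
      c.compContinuousLinearMap (ContinuousLinearMap.id ℝ (E d)) = c := by
    intro q c; ext; rfl
  simp only [hid] at h4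
  rw [h4]
  simp [ContinuousLinearMap.precompR, ContinuousLinearMap.precompL, add_comm]

/-- The exterior derivative of a product, first half: `A(f ∧ b) = A f ∧ b`. -/
theorem alternatizeUncurryFin_wedge_left (h : m + n = p) (h' : m + 1 + n = p + 1)
    (f : E d →L[ℝ] E d [⋀^Fin m]→L[ℝ] ℝ) (b : E d [⋀^Fin n]→L[ℝ] ℝ) :
    ContinuousAlternatingMap.alternatizeUncurryFin (((wedgeL h).flip b).comp f) =
      wedge h' (ContinuousAlternatingMap.alternatizeUncurryFin f) b := by
  ext v
  symm
  refine wedge_ext h' ?_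
  -- Both sides are multiples of `S`. On the left the inner product antisymmetrizes the last p
  -- slots, on the right the inner derivative antisymmetrizes the first m + 1 slots; the outer
  -- antisymmetrization absorbs these at the cost of p! and (m + 1)!.
  set S := asym (fun w : Fin (p + 1) → E d =>
    f (w 0) (w ∘ Fin.succ ∘ inlIdx h) * b (w ∘ Fin.succ ∘ inrIdx h)) v with hS
  have e1 : ((p.factorial : ℝ) * ((m.factorial : ℝ) * n.factorial)) *
      ContinuousAlternatingMap.alternatizeUncurryFin (((wedgeL h).flip b).comp f) v =
        (p.factorial : ℝ) * S := by
    choose e hs h0 hsucc using exists_perm_extend_succ (p := p)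
    rw [mul_comm (p.factorial : ℝ), mul_assoc, factorial_mul_alternatizeUncurryFin,
      ← asym_const_mul, hS, ← asym_sum_sign e hs]
    congr 1
    funext w
    simp only [ContinuousLinearMap.comp_apply, ContinuousLinearMap.flip_apply, wedgeL_apply]
    rw [factorial_mul_wedge]
    unfold asym
    refine Finset.sum_congr rfl fun τ _ => ?_
    simp only [Function.comp_apply, h0, Function.comp_assoc]
    rw [← Function.comp_assoc (e τ), hsucc, ← Function.comp_assoc (e τ), hsucc]
    rfl
  have e2 : (m.factorial : ℝ) * asym (fun w => ContinuousAlternatingMap.alternatizeUncurryFin f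
      (w ∘ inlIdx h') * b (w ∘ inrIdx h')) v = ((m + 1).factorial : ℝ) * S := by
    choose e hs hl hr using exists_perm_extend_inl h'
    rw [← asym_const_mul, hS, ← asym_sum_sign e hs]
    congr 1
    funext w
    rw [← mul_assoc, factorial_mul_alternatizeUncurryFin]
    unfold asym
    rw [Finset.sum_mul]
    refine Finset.sum_congr rfl fun τ _ => ?_
    have i0 : (0 : Fin (p + 1)) = inlIdx h' 0 := by ext; simp [inlIdx]
    have il : Fin.succ ∘ inlIdx h = inlIdx h' ∘ Fin.succ := by
      funext i; ext; simp [inlIdx]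
    have ir : Fin.succ ∘ inrIdx h = inrIdx h' := by
      funext i; ext; simp [inrIdx]; omega
    have h1 : (w ∘ e τ) ∘ inrIdx h' = w ∘ inrIdx h' := by rw [Function.comp_assoc, hr]
    have h2 : (w ∘ e τ) ∘ inlIdx h' = (w ∘ inlIdx h') ∘ τ := by
      rw [Function.comp_assoc, hl]; rfl
    rw [il, ir, h1, ← Function.comp_assoc, h2, i0, ← Function.comp_apply (f := w ∘ e τ), h2,
      mul_assoc]
  have hp : (p.factorial : ℝ) ≠ 0 := by positivity
  have hm : (m.factorial : ℝ) ≠ 0 := by positivity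
  have e1' := mul_left_cancel₀ hp ((mul_assoc _ _ _).symm.trans e1)
  refine mul_left_cancel₀ hm ?_
  rw [e2, ← e1']
  ring

theorem finRotate_pow_apply_val (p j : ℕ) (i : Fin p) :
    ((finRotate p ^ j : Perm (Fin p)) i : ℕ) = (i + j) % p := by
  obtain _ | q := p
  · exact i.elim0
  induction j with
  | zero => simp [Nat.mod_eq_of_lt i.2]
  | succ j ih =>
    rw [pow_succ', Equiv.Perm.mul_apply, finRotate_apply, Fin.val_add, ih]
    simp [Nat.add_assoc]

/-- Commutativity of the exterior product up to a sign, which is positive if the degree of the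
first factor is even. -/
theorem exists_sign_wedge_comm (d : ℕ) (h : m + n = p) (h' : n + m = p) : ∃ ε : ℝ,
    (Even m → ε = 1) ∧ ∀ (a : E d [⋀^Fin m]→L[ℝ] ℝ) (b : E d [⋀^Fin n]→L[ℝ] ℝ),
      wedge h a b = ε • wedge h' b a := by
  have hl : (finRotate p ^ m : Perm (Fin p)) ∘ inlIdx h' = inrIdx h := by
    funext i
    ext
    rw [Function.comp_apply, finRotate_pow_apply_val]
    simp only [inlIdx, inrIdx, Fin.val_cast, Fin.val_castAdd, Fin.val_natAdd]
    rw [Nat.mod_eq_of_lt (by omega), add_comm]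
  have hr : (finRotate p ^ m : Perm (Fin p)) ∘ inrIdx h' = inlIdx h := by
    funext i
    ext
    rw [Function.comp_apply, finRotate_pow_apply_val]
    simp only [inlIdx, inrIdx, Fin.val_cast, Fin.val_castAdd, Fin.val_natAdd]
    rw [show n + (i : ℕ) + m = i + p by omega, Nat.add_mod_right, Nat.mod_eq_of_lt (by omega)]
  -- Rotation by m exchanges the two blocks. Its sign is an m-th power, hence 1 for even m; no other
  -- value is needed.
  refine ⟨((sign (finRotate p ^ m : Perm (Fin p)) : ℤ) : ℝ), fun hm => ?_, fun a b => ?_⟩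
  · rw [map_pow]
    rcases Int.units_eq_one_or (sign (finRotate p)) with hs | hs
    · simp [hs]
    · simp [hs, hm.neg_one_pow]
  · ext v
    refine wedge_ext h ?_
    rw [ContinuousAlternatingMap.smul_apply, smul_eq_mul, mul_left_comm,
      mul_comm (m.factorial : ℝ), factorial_mul_wedge, ← asym_comp_perm]
    congr 1
    funext w
    rw [Function.comp_assoc, Function.comp_assoc, hl, hr, mul_comm]

theorem wedge_comm_of_even (h : m + n = p) (h' : n + m = p) (hm : Even m)
    (a : E d [⋀^Fin m]→L[ℝ] ℝ) (b : E d [⋀^Fin n]→L[ℝ] ℝ) : wedge h a b = wedge h' b a := by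
  obtain ⟨ε, hε, hc⟩ := exists_sign_wedge_comm d h h'
  rw [hc, hε hm, one_smul]

/-- The second half of the exterior derivative of a product vanishes with the exterior derivative
of the second factor. -/
theorem alternatizeUncurryFin_wedge_right_eq_zero (h : m + n = p)
    (a : E d [⋀^Fin m]→L[ℝ] ℝ) (g : E d →L[ℝ] E d [⋀^Fin n]→L[ℝ] ℝ)
    (hg : ContinuousAlternatingMap.alternatizeUncurryFin g = 0) :
    ContinuousAlternatingMap.alternatizeUncurryFin ((wedgeL h a).comp g) = 0 := by
  -- Commuting the factors reduces to the first half of the product rule; the sign is irrelevant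
  -- since the result is zero.
  obtain ⟨ε, -, hc⟩ := exists_sign_wedge_comm d h ((Nat.add_comm n m).trans h)
  have h1 : (wedgeL h a).comp g =
      ε • ((wedgeL ((Nat.add_comm n m).trans h)).flip a).comp g := by
    ext1 w
    exact hc a (g w)
  rw [h1, ContinuousAlternatingMap.alternatizeUncurryFin_smul,
    alternatizeUncurryFin_wedge_left _ (by omega), hg, ← wedgeL_apply, map_zero]
  simp

theorem wedge_constOfIsEmpty (h : 0 + n = n) (c : ℝ) (b : E d [⋀^Fin n]→L[ℝ] ℝ) :
    wedge h (ContinuousAlternatingMap.constOfIsEmpty ℝ (E d) (Fin 0) c) b = c • b := by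
  ext v
  refine wedge_ext h ?_
  have : inrIdx h = id := by funext i; ext; simp [inrIdx]
  simp [this, asym_const_mul, asym_alternating, mul_left_comm]

/-- The antisymmetrization of `w ↦ φ(w) b` is `φ ∧ b`. -/
theorem alternatizeUncurryFin_smulRight (h : 1 + n = n + 1) (φ : E d →L[ℝ] ℝ)
    (b : E d [⋀^Fin n]→L[ℝ] ℝ) :
    ContinuousAlternatingMap.alternatizeUncurryFin (φ.smulRight b) =
      wedge h (ContinuousAlternatingMap.ofSubsingleton ℝ (E d) ℝ (0 : Fin 1) φ) b := by
  have h0 : 0 + n = n := Nat.zero_add n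
  -- Scalars are read as 0-forms, so that `φ.smulRight b` becomes a product with `b` and the first
  -- half of the product rule applies.
  rw [← ContinuousAlternatingMap.alternatizeUncurryFin_constOfIsEmptyLIE_comp,
    ← alternatizeUncurryFin_wedge_left h0]
  congr 1
  ext1 w
  exact (wedge_constOfIsEmpty h0 (φ w) b).symm

end wedge

theorem minSmoothness_two_le_infty : minSmoothness ℝ 2 ≤ ∞ := by
  rw [minSmoothness_of_isRCLikeNormedField]
  exact ENat.LEInfty.out

/-! ### Partial derivatives on products of regular sets -/

/-- Sets on which derivatives are unique and second derivatives are symmetric. -/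
structure IsRegular {V : Type*} [NormedAddCommGroup V] [NormedSpace ℝ V] (s : Set V) : Prop where
  uniqueDiffOn : UniqueDiffOn ℝ s
  subset_closure : s ⊆ closure (interior s)

section partials

variable {V W F G : Type*} [NormedAddCommGroup V] [NormedSpace ℝ V] [NormedAddCommGroup W]
  [NormedSpace ℝ W] [NormedAddCommGroup F] [NormedSpace ℝ F] [NormedAddCommGroup G]
  [NormedSpace ℝ G] {J : Set ℝ} {K : Set V}

theorem _root_.Convex.isRegular {s : Set V} (hs : Convex ℝ s) (hi : (interior s).Nonempty) :
    IsRegular s :=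
  ⟨uniqueDiffOn_convex hs hi, fun _ hx => by
    rw [hs.closure_interior_eq_closure_of_nonempty_interior hi]; exact subset_closure hx⟩

theorem IsRegular.univ : IsRegular (univ : Set V) :=
  ⟨uniqueDiffOn_univ, by simp⟩

theorem IsRegular.prod {s : Set V} {t : Set W} (hs : IsRegular s) (ht : IsRegular t) :
    IsRegular (s ×ˢ t) :=
  ⟨hs.1.prod ht.1, by
    rw [interior_prod_eq, closure_prod_eq]; exact prod_mono hs.2 ht.2⟩

theorem fderiv_clm_comp {X : Type*} [NormedAddCommGroup X] [NormedSpace ℝ X] (T : F →L[ℝ] G)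
    {f : X → F} {x : X} (hf : DifferentiableAt ℝ f x) (v : X) :
    fderiv ℝ (fun y => T (f y)) x v = T (fderiv ℝ f x v) :=
  congrArg (fun L => L v) (T.hasFDerivAt.comp x hf.hasFDerivAt).fderiv

theorem fderiv_extDeriv {n : ℕ} {α : V → V [⋀^Fin n]→L[ℝ] F} (hα : ContDiff ℝ ∞ α) (x v : V) :
    fderiv ℝ (extDeriv α) x v =
      ContinuousAlternatingMap.alternatizeUncurryFin (fderiv ℝ (fderiv ℝ α) x v) :=
  fderiv_clm_comp (ContinuousAlternatingMap.alternatizeUncurryFinCLM ℝ V F)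
    ((hα.fderiv_right (m := ∞) (by simp)).differentiable (by simp) x) v

theorem contDiff_clm_comp {X : Type*} [NormedAddCommGroup X] [NormedSpace ℝ X] (T : F →L[ℝ] G)
    {f : X → F} (hf : ContDiff ℝ ∞ f) : ContDiff ℝ ∞ (fun y => T (f y)) :=
  T.contDiff.comp hf

theorem contDiffOn_clm₂ {X : Type*} [NormedAddCommGroup X] [NormedSpace ℝ X]
    (T : V →L[ℝ] F →L[ℝ] G) {f : X → V} {g : X → F} {s : Set X} (hf : ContDiffOn ℝ ∞ f s)
    (hg : ContDiffOn ℝ ∞ g s) : ContDiffOn ℝ ∞ (fun y => T (f y) (g y)) s :=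
  (T.contDiff.comp_contDiffOn hf).clm_apply hg

theorem hasFDerivAt_clm₂ {X : Type*} [NormedAddCommGroup X] [NormedSpace ℝ X]
    (T : V →L[ℝ] F →L[ℝ] G) {f : X → V} {g : X → F} {x : X} {f' : X →L[ℝ] V} {g' : X →L[ℝ] F}
    (hf : HasFDerivAt f f' x) (hg : HasFDerivAt g g' x) :
    HasFDerivAt (fun y => T (f y) (g y)) ((T (f x)).comp g' + (T.flip (g x)).comp f') x :=
  T.hasFDerivAt_of_bilinear hf hg

/-- Smoothness of a time-dependent map on a set. -/
def SmoothFamily (J : Set ℝ) (K : Set V) (α : ℝ → V → F) : Prop :=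
  ContDiffOn ℝ ∞ (fun z : ℝ × V => α z.1 z.2) (J ×ˢ K)

/-- The derivative in space and time. -/
def totalDeriv (J : Set ℝ) (K : Set V) (α : ℝ → V → F) (t : ℝ) (x : V) : ℝ × V →L[ℝ] F :=
  fderivWithin ℝ (fun z : ℝ × V => α z.1 z.2) (J ×ˢ K) (t, x)

variable {α : ℝ → V → F} {t : ℝ} {x : V}

theorem SmoothFamily.hasFDerivWithinAt (h : SmoothFamily J K α) (ht : t ∈ J) (hx : x ∈ K) :
    HasFDerivWithinAt (fun z : ℝ × V => α z.1 z.2) (totalDeriv J K α t x) (J ×ˢ K) (t, x) :=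
  ((h (t, x) ⟨ht, hx⟩).differentiableWithinAt (by simp)).hasFDerivWithinAt

theorem SmoothFamily.hasDerivWithinAt_time (h : SmoothFamily J K α) (ht : t ∈ J) (hx : x ∈ K) :
    HasDerivWithinAt (fun s => α s x) (totalDeriv J K α t x (1, 0)) J t := by
  have h1 : HasDerivWithinAt (fun s : ℝ => (s, x)) ((1 : ℝ), (0 : V)) J t :=
    (hasDerivWithinAt_id t J).prodMk (hasDerivWithinAt_const t J x)
  exact HasFDerivWithinAt.comp_hasDerivWithinAt t (h.hasFDerivWithinAt ht hx) h1
    fun s hs => mk_mem_prod hs hx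

theorem SmoothFamily.hasFDerivWithinAt_space (h : SmoothFamily J K α) (ht : t ∈ J) (hx : x ∈ K) :
    HasFDerivWithinAt (α t) ((totalDeriv J K α t x).comp (ContinuousLinearMap.inr ℝ ℝ V)) K x := by
  have h1 : HasFDerivWithinAt (fun y : V => (t, y)) (ContinuousLinearMap.inr ℝ ℝ V) K x :=
    (hasFDerivWithinAt_const t x K).prodMk (hasFDerivWithinAt_id x K)
  exact HasFDerivWithinAt.comp x (h.hasFDerivWithinAt ht hx) h1 fun _ hy => mk_mem_prod ht hy

theorem SmoothFamily.contDiffOn (h : SmoothFamily J K α) (ht : t ∈ J) : ContDiffOn ℝ ∞ (α t) K :=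
  ContDiffOn.comp h (f := fun x : V => (t, x)) (by fun_prop) fun _ hx => ⟨ht, hx⟩

theorem SmoothFamily.derivWithin_eq (h : SmoothFamily J K α) (hJ : IsRegular J) (ht : t ∈ J)
    (hx : x ∈ K) : derivWithin (fun s => α s x) J t = totalDeriv J K α t x (1, 0) :=
  (h.hasDerivWithinAt_time ht hx).derivWithin (hJ.1 t ht)

theorem SmoothFamily.fderivWithin_eq (h : SmoothFamily J K α) (hK : IsRegular K) (ht : t ∈ J)
    (hx : x ∈ K) : fderivWithin ℝ (α t) K x =
      (totalDeriv J K α t x).comp (ContinuousLinearMap.inr ℝ ℝ V) :=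
  (h.hasFDerivWithinAt_space ht hx).fderivWithin (hK.1 x hx)

theorem SmoothFamily.smooth_totalDeriv (h : SmoothFamily J K α) (hJ : IsRegular J)
    (hK : IsRegular K) : SmoothFamily J K (totalDeriv J K α) :=
  ContDiffOn.fderivWithin h (hJ.prod hK).1 (by simp)

theorem SmoothFamily.clm_comp (h : SmoothFamily J K α) (L : F →L[ℝ] G) :
    SmoothFamily J K (fun t x => L (α t x)) :=
  L.contDiff.comp_contDiffOn h

theorem SmoothFamily.congr {β : ℝ → V → F} (h : SmoothFamily J K α)
    (hβ : ∀ t ∈ J, ∀ x ∈ K, β t x = α t x) : SmoothFamily J K β :=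
  ContDiffOn.congr h fun z hz => hβ z.1 hz.1 z.2 hz.2

theorem SmoothFamily.derivWithin_time (h : SmoothFamily J K α) (hJ : IsRegular J)
    (hK : IsRegular K) : SmoothFamily J K (fun t x => derivWithin (fun s => α s x) J t) :=
  ((h.smooth_totalDeriv hJ hK).clm_comp (ContinuousLinearMap.apply ℝ F ((1 : ℝ), (0 : V)))).congr
    fun _ ht _ hx => h.derivWithin_eq hJ ht hx

theorem SmoothFamily.fderivWithin_space (h : SmoothFamily J K α) (hJ : IsRegular J)
    (hK : IsRegular K) : SmoothFamily J K (fun t => fderivWithin ℝ (α t) K) :=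
  ((h.smooth_totalDeriv hJ hK).clm_comp ((ContinuousLinearMap.compL ℝ V (ℝ × V) F).flip
    (ContinuousLinearMap.inr ℝ ℝ V))).congr fun _ ht _ hx => h.fderivWithin_eq hK ht hx

/-- The derivatives in time and in space commute. -/
theorem SmoothFamily.hasDerivWithinAt_fderivWithin (h : SmoothFamily J K α) (hJ : IsRegular J)
    (hK : IsRegular K) (ht : t ∈ J) (hx : x ∈ K) :
    HasDerivWithinAt (fun s => fderivWithin ℝ (α s) K x)
      (fderivWithin ℝ (fun y => derivWithin (fun s => α s y) J t) K x) J t := by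
  have hT := h.smooth_totalDeriv hJ hK
  set D := totalDeriv J K (totalDeriv J K α) t x with hD
  -- The second derivative is taken jointly in space-time. Its symmetry persists at boundary points
  -- because `J ×ˢ K` lies in the closure of its interior.
  have hsymm : ∀ v w, D v w = D w v :=
    (h (t, x) ⟨ht, hx⟩).isSymmSndFDerivWithinAt minSmoothness_two_le_infty (hJ.prod hK).1
      ((hJ.prod hK).2 ⟨ht, hx⟩) ⟨ht, hx⟩
  have h1 : fderivWithin ℝ (fun y => derivWithin (fun s => α s y) J t) K x =
      ((ContinuousLinearMap.apply ℝ F ((1 : ℝ), (0 : V))).comp D).comp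
        (ContinuousLinearMap.inr ℝ ℝ V) := by
    have h2 : HasFDerivWithinAt (fun y => derivWithin (fun s => α s y) J t) _ K x :=
      (((ContinuousLinearMap.apply ℝ F ((1 : ℝ), (0 : V))).hasFDerivAt.comp_hasFDerivWithinAt x
        (hT.hasFDerivWithinAt_space ht hx)).congr (fun y hy => h.derivWithin_eq hJ ht hy)
          (h.derivWithin_eq hJ ht hx))
    exact h2.fderivWithin (hK.1 x hx)
  have h3 : HasDerivWithinAt (fun s => (totalDeriv J K α s x).comp
      (ContinuousLinearMap.inr ℝ ℝ V)) ((D (1, 0)).comp (ContinuousLinearMap.inr ℝ ℝ V)) J t :=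
    ((ContinuousLinearMap.compL ℝ V (ℝ × V) F).flip
      (ContinuousLinearMap.inr ℝ ℝ V)).hasFDerivAt.comp_hasDerivWithinAt t
        (hT.hasDerivWithinAt_time ht hx)
  refine (h3.congr (fun s hs => h.fderivWithin_eq hK hs hx) (h.fderivWithin_eq hK ht
    hx)).congr_deriv ?_
  rw [h1]
  ext v
  exact hsymm _ _

theorem SmoothFamily.contDiff {α : ℝ → V → F} (h : SmoothFamily J univ α) (ht : t ∈ J) :
    ContDiff ℝ ∞ (α t) :=
  contDiffOn_univ.1 (h.contDiffOn ht)

theorem SmoothFamily.fderiv_space {α : ℝ → V → F} (h : SmoothFamily J univ α) (hJ : IsRegular J) :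
    SmoothFamily J univ (fun t => fderiv ℝ (α t)) := by
  simpa only [fderivWithin_univ] using h.fderivWithin_space hJ IsRegular.univ

end partials

/-! ### Calculus of forms -/

section forms

variable {d m n p : ℕ} {J : Set ℝ}

local notation "A" => ContinuousAlternatingMap.alternatizeUncurryFin

/-- With a closed second factor the product rule has only its sign-free term, the one case needed
for the powers of dθ. -/
theorem extDeriv_wedge (h : m + n = p) (h' : m + 1 + n = p + 1) {a : Form d m} {b : Form d n}
    {x : E d} (ha : DifferentiableAt ℝ a x) (hb : DifferentiableAt ℝ b x)
    (hdb : extDeriv b x = 0) :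
    extDeriv (fun y => wedge h (a y) (b y)) x = wedge h' (extDeriv a x) (b x) := by
  have h1 : fderiv ℝ (fun y => wedge h (a y) (b y)) x =
      (wedgeL h (a x)).comp (fderiv ℝ b x) + ((wedgeL h).flip (b x)).comp (fderiv ℝ a x) := by
    have := (wedgeL h).hasFDerivAt_of_bilinear ha.hasFDerivAt hb.hasFDerivAt
    exact this.fderiv
  rw [extDeriv, h1, ContinuousAlternatingMap.alternatizeUncurryFin_add,
    alternatizeUncurryFin_wedge_right_eq_zero h _ _ hdb, zero_add,
    alternatizeUncurryFin_wedge_left h h']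
  rfl

theorem extDeriv_smul_form (h : 1 + n = n + 1) {q : E d → ℝ} {b : Form d n}
    {x : E d} (hq : DifferentiableAt ℝ q x) (hb : DifferentiableAt ℝ b x)
    (hdb : extDeriv b x = 0) :
    extDeriv (fun y => q y • b y) x =
      wedge h (ContinuousAlternatingMap.ofSubsingleton ℝ (E d) ℝ (0 : Fin 1) (fderiv ℝ q x))
        (b x) := by
  rw [extDeriv] at hdb
  rw [extDeriv, fderiv_fun_smul hq hb, ContinuousAlternatingMap.alternatizeUncurryFin_add,
    ContinuousAlternatingMap.alternatizeUncurryFin_smul, hdb, smul_zero, zero_add,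
    alternatizeUncurryFin_smulRight h]

theorem contDiff_wedge {X : Type*} [NormedAddCommGroup X] [NormedSpace ℝ X] (h : m + n = p)
    {a : X → E d [⋀^Fin m]→L[ℝ] ℝ} {b : X → E d [⋀^Fin n]→L[ℝ] ℝ} {s : Set X}
    (ha : ContDiffOn ℝ ∞ a s) (hb : ContDiffOn ℝ ∞ b s) :
    ContDiffOn ℝ ∞ (fun y => wedge h (a y) (b y)) s :=
  contDiffOn_clm₂ (wedgeL h) ha hb

theorem SmoothFamily.wedge (h : m + n = p) {a : ℝ → Form d m} {b : ℝ → Form d n}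
    (ha : SmoothFamily J univ a) (hb : SmoothFamily J univ b) :
    SmoothFamily J univ (fun t x => wedge h (a t x) (b t x)) :=
  contDiff_wedge h ha hb

theorem SmoothFamily.extDeriv {a : ℝ → Form d m} (ha : SmoothFamily J univ a) (hJ : IsRegular J) :
    SmoothFamily J univ (fun t => extDeriv (a t)) :=
  (ha.fderiv_space hJ).clm_comp (ContinuousAlternatingMap.alternatizeUncurryFinCLM ℝ (E d) ℝ)

theorem SmoothFamily.dPow {θ : ℝ → Form d 1} (hθ : SmoothFamily J univ θ) (hJ : IsRegular J) :
    ∀ k, SmoothFamily J univ (fun t => dPow (θ t) k)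
  | 0 => contDiffOn_const
  | k + 1 => (hθ.dPow hJ k).wedge _ (hθ.extDeriv hJ)

theorem SmoothFamily.H {θ : ℝ → Form d 1} (hθ : SmoothFamily J univ θ) (hJ : IsRegular J) (k : ℕ) :
    SmoothFamily J univ (fun t => H (θ t) k) :=
  hθ.wedge _ (hθ.dPow hJ k)

theorem contDiff_extDeriv {a : Form d m} (ha : ContDiff ℝ ∞ a) : ContDiff ℝ ∞ (extDeriv a) := by
  have h1 : ContDiff ℝ ∞ (fderiv ℝ a) := ha.fderiv_right (by simp)
  exact contDiff_clm_comp (ContinuousAlternatingMap.alternatizeUncurryFinCLM ℝ (E d) ℝ) h1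

theorem contDiff_dPow {θ : Form d 1} (hθ : ContDiff ℝ ∞ θ) : ∀ k, ContDiff ℝ ∞ (dPow θ k)
  | 0 => contDiff_const
  | k + 1 => contDiffOn_univ.1 (contDiff_wedge _ (contDiff_dPow hθ k).contDiffOn
      (contDiff_extDeriv hθ).contDiffOn)

theorem contDiff_H {θ : Form d 1} (hθ : ContDiff ℝ ∞ θ) (k : ℕ) : ContDiff ℝ ∞ (H θ k) :=
  contDiffOn_univ.1 (contDiff_wedge _ hθ.contDiffOn (contDiff_dPow hθ k).contDiffOn)

theorem extDeriv_dPow {θ : Form d 1} (hθ : ContDiff ℝ ∞ θ) (k : ℕ) (x : E d) :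
    extDeriv (dPow θ k) x = 0 := by
  induction k generalizing x with
  | zero =>
    have : fderiv ℝ (dPow θ 0) x = 0 := by
      exact (hasFDerivAt_const _ x).fderiv
    rw [extDeriv, this, ← ContinuousAlternatingMap.alternatizeUncurryFinCLM_apply, map_zero]
  | succ k ih =>
    have h2 : extDeriv (extDeriv θ) x = 0 :=
      extDeriv_extDeriv_apply hθ.contDiffAt minSmoothness_two_le_infty
    have h3 := extDeriv_wedge (Nat.mul_succ 2 k).symm (h' := by omega)
      ((contDiff_dPow hθ k).differentiable (by simp) x)
      ((contDiff_extDeriv hθ).differentiable (by simp) x) h2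
    refine Eq.trans h3 ?_
    rw [ih, ← wedgeL_apply, map_zero]
    rfl

theorem extDeriv_H {θ : Form d 1} (hθ : ContDiff ℝ ∞ θ) (k : ℕ) (x : E d) :
    extDeriv (H θ k) x = dPow θ (k + 1) x := by
  have h3 := extDeriv_wedge (Nat.add_comm 1 (2 * k)) (h' := by omega)
    (hθ.differentiable (by simp) x)
    ((contDiff_dPow hθ k).differentiable (by simp) x) (extDeriv_dPow hθ k x)
  -- The product rule puts the new factor dθ on the left, `dPow` on the right; dθ has even degree.
  exact h3.trans (wedge_comm_of_even _ _ (by decide) _ _)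

/-! ### The material derivative -/

variable {u : ℝ → E d → E d} {t : ℝ}

/-- Time and convective derivatives merge into one space-time derivative in the direction (1, u),
the form suited to product and chain rules. -/
theorem matDeriv_eq {α : ℝ → Form d n} (hα : SmoothFamily J univ α) (hJ : IsRegular J)
    (ht : t ∈ J) (x : E d) : matDeriv J u α t x = totalDeriv J univ α t x (1, u t x) +
      (α t x).fderivCompContinuousLinearMap (ContinuousLinearMap.id ℝ (E d))
        (fderiv ℝ (u t) x) := by
  have h1 := hα.fderivWithin_eq IsRegular.univ ht (mem_univ x)
  rw [fderivWithin_univ] at h1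
  rw [matDeriv, lieDeriv, hα.derivWithin_eq hJ ht (mem_univ x), h1, ← add_assoc]
  congr 1
  rw [ContinuousLinearMap.comp_apply, ← map_add]
  simp

theorem matDeriv_wedge (h : m + n = p) {a : ℝ → Form d m} {b : ℝ → Form d n}
    (ha : SmoothFamily J univ a) (hb : SmoothFamily J univ b) (hJ : IsRegular J)
    (ht : t ∈ J) (x : E d) :
    matDeriv J u (fun t x => wedge h (a t x) (b t x)) t x =
      wedge h (matDeriv J u a t x) (b t x) + wedge h (a t x) (matDeriv J u b t x) := by
  rw [matDeriv_eq (ha.wedge h hb) hJ ht, matDeriv_eq ha hJ ht, matDeriv_eq hb hJ ht]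
  have h1 : totalDeriv J univ (fun t x => wedge h (a t x) (b t x)) t x =
      (wedgeL h (a t x)).comp (totalDeriv J univ b t x) +
        ((wedgeL h).flip (b t x)).comp (totalDeriv J univ a t x) :=
    ((wedgeL h).hasFDerivWithinAt_of_bilinear (ha.hasFDerivWithinAt ht (mem_univ x))
      (hb.hasFDerivWithinAt ht (mem_univ x))).fderivWithin
        ((hJ.prod IsRegular.univ).1 (t, x) ⟨ht, mem_univ x⟩)
  rw [h1, wedge_fderivComp, wedge_add_left, wedge_add_right]
  simp only [add_apply, ContinuousLinearMap.comp_apply, ContinuousLinearMap.flip_apply,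
    wedgeL_apply]
  abel

/-- The infinitesimal pullback inserts `L` into one slot at a time: either into the slot of the
differentiating vector or into one of the remaining n. This is the algebraic half of the commutation
of L_u with d. -/
theorem alternatizeUncurryFin_fderivComp (f : E d →L[ℝ] E d [⋀^Fin n]→L[ℝ] ℝ)
    (L : E d →L[ℝ] E d) :
    A (f.comp L) + A (((ContinuousAlternatingMap.fderivCompContinuousLinearMapCLM ℝ
      (ContinuousLinearMap.id ℝ (E d))).flip L).comp f) =
      (A f).fderivCompContinuousLinearMap (ContinuousLinearMap.id ℝ (E d)) L := by
  ext v
  simp only [ContinuousAlternatingMap.add_apply,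
    ContinuousAlternatingMap.alternatizeUncurryFin_apply,
    ContinuousAlternatingMap.fderivCompContinuousLinearMap_apply, ContinuousLinearMap.comp_apply,
    ContinuousLinearMap.flip_apply,
    ContinuousAlternatingMap.fderivCompContinuousLinearMapCLM_apply, ← Finset.sum_add_distrib]
  rw [Finset.sum_comm]
  refine Finset.sum_congr rfl fun i _ => ?_
  rw [← Finset.smul_sum, ← smul_add]
  congr 1
  rw [Fin.sum_univ_succAbove _ i]
  congr 1
  · simp only [Function.update_self]
    congr 1
    funext k
    simp [Fin.removeNth]
  · refine Finset.sum_congr rfl fun j _ => ?_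
    rw [Function.update_of_ne (Fin.succAbove_ne i j).symm]
    simp only [ContinuousLinearMap.id_apply]
    congr 1
    funext k
    simp only [Fin.removeNth]
    rcases eq_or_ne k j with rfl | hk
    · simp
    · rw [Function.update_of_ne hk,
        Function.update_of_ne (fun h => hk (Fin.succAbove_right_injective h))]

theorem hasFDerivAt_fderivComp {a : Form d n} {L : E d → E d →L[ℝ] E d} {x : E d}
    {a' : E d →L[ℝ] E d [⋀^Fin n]→L[ℝ] ℝ} {L' : E d →L[ℝ] E d →L[ℝ] E d}
    (ha : HasFDerivAt a a' x) (hL : HasFDerivAt L L' x) :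
    HasFDerivAt (fun y =>
        (a y).fderivCompContinuousLinearMap (ContinuousLinearMap.id ℝ (E d)) (L y))
      (((a x).fderivCompContinuousLinearMap (ContinuousLinearMap.id ℝ (E d))).comp L' +
        ((ContinuousAlternatingMap.fderivCompContinuousLinearMapCLM ℝ
          (ContinuousLinearMap.id ℝ (E d))).flip (L x)).comp a') x :=
  hasFDerivAt_clm₂ (ContinuousAlternatingMap.fderivCompContinuousLinearMapCLM (ι := Fin n) ℝ
    (ContinuousLinearMap.id ℝ (E d))) ha hL

/-- The material derivative commutes with the exterior derivative. -/
theorem extDeriv_matDeriv {α : ℝ → Form d n} (hα : SmoothFamily J univ α)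
    (hu : SmoothFamily J univ u) (hJ : IsRegular J) (ht : t ∈ J) (x : E d) :
    extDeriv (matDeriv J u α t) x = matDeriv J u (fun s => extDeriv (α s)) t x := by
  have cα := hα.contDiff ht
  have cu := hu.contDiff ht
  have hα1 : HasFDerivAt (α t) (fderiv ℝ (α t) x) x :=
    (cα.differentiable (by simp) x).hasFDerivAt
  have hu1 : HasFDerivAt (u t) (fderiv ℝ (u t) x) x :=
    (cu.differentiable (by simp) x).hasFDerivAt
  have hα2 : HasFDerivAt (fderiv ℝ (α t)) (fderiv ℝ (fderiv ℝ (α t)) x) x :=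
    (((cα.fderiv_right (m := ∞) (by simp))).differentiable (by simp) x).hasFDerivAt
  have hu2 : HasFDerivAt (fderiv ℝ (u t)) (fderiv ℝ (fderiv ℝ (u t)) x) x :=
    (((cu.fderiv_right (m := ∞) (by simp))).differentiable (by simp) x).hasFDerivAt
  have hmix := hα.hasDerivWithinAt_fderivWithin hJ IsRegular.univ ht (mem_univ x)
  simp only [fderivWithin_univ] at hmix
  set M := fderiv ℝ (fun y => derivWithin (fun s => α s y) J t) x with hM
  have d1 : HasFDerivAt (fun y => derivWithin (fun s => α s y) J t) M x :=
    (((hα.derivWithin_time hJ IsRegular.univ).contDiff ht).differentiable (by simp) x).hasFDerivAt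
  have d2 := hα2.clm_apply hu1
  -- Differentiating Dα(u) produces D²α(·)(u); by symmetry it is D²α(u), the convective derivative
  -- of Dα.
  have hsα : (fderiv ℝ (fderiv ℝ (α t)) x).flip (u t x) = fderiv ℝ (fderiv ℝ (α t)) x (u t x) := by
    ext1 w
    exact cα.contDiffAt.isSymmSndFDerivAt minSmoothness_two_le_infty _ _
  rw [hsα] at d2
  have d3 := hasFDerivAt_fderivComp hα1 hu2
  have dd := d1.add (d2.add d3)
  have e1 : derivWithin (fun s => extDeriv (α s) x) J t = A M :=
    ((ContinuousAlternatingMap.alternatizeUncurryFinCLM ℝ (E d)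
      ℝ).hasFDerivAt.comp_hasDerivWithinAt t hmix).derivWithin (hJ.1 t ht)
  have e2 : fderiv ℝ (extDeriv (α t)) x (u t x) = A (fderiv ℝ (fderiv ℝ (α t)) x (u t x)) :=
    fderiv_extDeriv cα x (u t x)
  have e3 := alternatizeUncurryFin_fderivComp (fderiv ℝ (α t) x) (fderiv ℝ (u t) x)
  -- The only term without a counterpart contains D²u, which is symmetric and so is killed by
  -- antisymmetrization.
  have e4 := ContinuousAlternatingMap.alternatizeUncurryFin_fderivCompContinuousLinearMap_eq_zero
    (α t x) (ContinuousLinearMap.id ℝ (E d))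
    (cu.contDiffAt.isSymmSndFDerivAt (x := x) minSmoothness_two_le_infty)
  have e5 : extDeriv (matDeriv J u α t) x = A _ := congrArg A dd.fderiv
  have e6 : extDeriv (α t) x = A (fderiv ℝ (α t) x) := rfl
  rw [e5, matDeriv, lieDeriv, e1, e2, e6, ← e3]
  simp only [ContinuousAlternatingMap.alternatizeUncurryFin_add]
  rw [e4]
  abel

end forms

/-! ### Stokes' theorem on a cube -/

open MeasureTheory

section stokes

variable {n : ℕ}

theorem isRegular_Icc (n : ℕ) : IsRegular (Icc (0 : Fin n → ℝ) 1) := by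
  refine (convex_Icc 0 1).isRegular ⟨fun _ => 1 / 2, ?_⟩
  rw [← pi_univ_Icc, interior_pi_set finite_univ]
  intro i _
  simp only [Pi.zero_apply, Pi.one_apply, interior_Icc]
  norm_num

theorem continuousOn_alternating_apply {ι X V F : Type*} [Fintype ι] [TopologicalSpace X]
    [NormedAddCommGroup V] [NormedSpace ℝ V] [NormedAddCommGroup F] [NormedSpace ℝ F]
    {a : X → V [⋀^ι]→L[ℝ] F} {w : ι → X → V} {s : Set X} (ha : ContinuousOn a s)
    (hw : ∀ i, ContinuousOn (w i) s) : ContinuousOn (fun x => a x (fun i => w i x)) s := by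
  have h : Continuous fun z : (V [⋀^ι]→L[ℝ] F) × (ι → V) => z.1 z.2 := by fun_prop
  exact h.comp_continuousOn (ha.prodMk (continuousOn_pi.2 hw))

/-- The linear part of the inclusion of the `i`-th faces of a cube. -/
def faceIncl (i : Fin (n + 1)) : (Fin n → ℝ) →L[ℝ] (Fin (n + 1) → ℝ) :=
  ContinuousLinearMap.pi (i.insertNth (α := fun _ => (Fin n → ℝ) →L[ℝ] ℝ) 0
    fun j => ContinuousLinearMap.proj j)

theorem faceIncl_single (i : Fin (n + 1)) (j : Fin n) :
    faceIncl i (Pi.single j 1) = Pi.single (i.succAbove j) 1 := by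
  funext k
  refine i.succAboveCases ?_ (fun k => ?_) k
  · simp [faceIncl]
  · simp [faceIncl, Pi.single_apply]

theorem hasFDerivAt_insertNth (i : Fin (n + 1)) (ε : ℝ) (x : Fin n → ℝ) :
    HasFDerivAt (fun y : Fin n → ℝ => (i.insertNth ε y : Fin (n + 1) → ℝ)) (faceIncl i) x := by
  refine hasFDerivAt_pi.2 fun k => ?_
  refine i.succAboveCases ?_ (fun k => ?_) k
  · simpa using hasFDerivAt_const ε x
  · simpa using hasFDerivAt_apply k x

theorem insertNth_mem_Icc (i : Fin (n + 1)) {ε : ℝ} (hε : ε ∈ Icc (0 : ℝ) 1) {x : Fin n → ℝ}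
    (hx : x ∈ Icc (0 : Fin n → ℝ) 1) :
    (i.insertNth ε x : Fin (n + 1) → ℝ) ∈ Icc (0 : Fin (n + 1) → ℝ) 1 := by
  refine ⟨fun j => ?_, fun j => ?_⟩
  · refine i.succAboveCases ?_ (fun j => ?_) j
    · simpa using hε.1
    · simpa using hx.1 j
  · refine i.succAboveCases ?_ (fun j => ?_) j
    · simpa using hε.2
    · simpa using hx.2 j

variable {V : Type*} [NormedAddCommGroup V] [NormedSpace ℝ V]

/-- The function of which `cubeIntegral` is the integral. -/
def pullbackDensity (β : V → V [⋀^Fin n]→L[ℝ] ℝ) (g : (Fin n → ℝ) → V) (y : Fin n → ℝ) : ℝ :=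
  β (g y) fun i => fderivWithin ℝ g (Icc 0 1) y (Pi.single i 1)

theorem continuousOn_fderivWithin_Icc {g : (Fin n → ℝ) → V} (hg : ContDiffOn ℝ ∞ g (Icc 0 1)) :
    ContinuousOn (fderivWithin ℝ g (Icc 0 1)) (Icc 0 1) :=
  hg.continuousOn_fderivWithin (isRegular_Icc n).1 (by simp)

theorem continuousOn_pullbackDensity {β : V → V [⋀^Fin n]→L[ℝ] ℝ} {g : (Fin n → ℝ) → V}
    (hβ : Continuous β) (hg : ContDiffOn ℝ ∞ g (Icc 0 1)) :
    ContinuousOn (pullbackDensity β g) (Icc 0 1) :=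
  continuousOn_alternating_apply (hβ.comp_continuousOn hg.continuousOn) fun _ =>
    (continuousOn_fderivWithin_Icc hg).clm_apply continuousOn_const

theorem pullbackDensity_face (β : V → V [⋀^Fin n]→L[ℝ] ℝ) {g : (Fin (n + 1) → ℝ) → V}
    (hg : ContDiffOn ℝ ∞ g (Icc 0 1)) (i : Fin (n + 1)) {ε : ℝ} (hε : ε ∈ Icc (0 : ℝ) 1)
    {x : Fin n → ℝ} (hx : x ∈ Icc (0 : Fin n → ℝ) 1) :
    pullbackDensity β (fun y => g (i.insertNth ε y)) x =
      β (g (i.insertNth ε x)) fun j =>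
        fderivWithin ℝ g (Icc 0 1) (i.insertNth ε x) (Pi.single (i.succAbove j) 1) := by
  have hm := insertNth_mem_Icc i hε hx
  have h1 : HasFDerivWithinAt (fun y => g (i.insertNth ε y))
      ((fderivWithin ℝ g (Icc 0 1) (i.insertNth ε x)).comp (faceIncl i)) (Icc 0 1) x :=
    HasFDerivWithinAt.comp x ((hg _ hm).differentiableWithinAt (by simp)).hasFDerivWithinAt
      (hasFDerivAt_insertNth i ε x).hasFDerivWithinAt fun y hy => insertNth_mem_Icc i hε hy
  rw [pullbackDensity, h1.fderivWithin ((isRegular_Icc n).1 x hx)]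
  simp only [ContinuousLinearMap.comp_apply, faceIncl_single]

/-- Stokes on the cube is the divergence theorem for the field whose i-th component is (-1)^i times
the pulled-back form evaluated on the basis with its i-th vector removed. -/
theorem integral_pullbackDensity_extDeriv {β : V → V [⋀^Fin n]→L[ℝ] ℝ} (hβ : ContDiff ℝ ∞ β)
    {g : (Fin (n + 1) → ℝ) → V} (hg : ContDiffOn ℝ ∞ g (Icc 0 1)) :
    ∫ y in Icc (0 : Fin (n + 1) → ℝ) 1, pullbackDensity (extDeriv β) g y =
      ∑ i : Fin (n + 1), (-1 : ℝ) ^ (i : ℕ) *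
        ((∫ y in Icc (0 : Fin n → ℝ) 1, pullbackDensity β (fun y => g (i.insertNth 1 y)) y) -
          ∫ y in Icc (0 : Fin n → ℝ) 1, pullbackDensity β (fun y => g (i.insertNth 0 y)) y) := by
  set K := Icc (0 : Fin (n + 1) → ℝ) 1 with hK
  have hr := isRegular_Icc (n + 1)
  set e : Fin (n + 1) → Fin (n + 1) → ℝ := fun i => Pi.single i 1 with he
  set η : (Fin (n + 1) → ℝ) → (Fin (n + 1) → ℝ) [⋀^Fin n]→L[ℝ] ℝ := fun y =>
    (β (g y)).compContinuousLinearMap (fderivWithin ℝ g K y) with hη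
  have hDg : ContDiffOn ℝ ∞ (fderivWithin ℝ g K) K := hg.fderivWithin hr.1 (by simp)
  have dη : ∀ y ∈ K, DifferentiableWithinAt ℝ η K y := fun y hy =>
    DifferentiableWithinAt.continuousAlternatingMapCompContinuousLinearMap
      ((hβ.differentiable (by simp) (g y)).comp_differentiableWithinAt y
        ((hg y hy).differentiableWithinAt (by simp))) ((hDg y hy).differentiableWithinAt (by simp))
  set f : Fin (n + 1) → (Fin (n + 1) → ℝ) → ℝ := fun i y =>
    (-1 : ℝ) ^ (i : ℕ) * η y (i.removeNth e) with hf
  have df : ∀ i, ∀ y ∈ K, HasFDerivWithinAt (f i) ((-1 : ℝ) ^ (i : ℕ) •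
      fderivWithin ℝ (fun y => η y (i.removeNth e)) K y) K y := by
    intro i y hy
    have h1 : DifferentiableWithinAt ℝ (fun y => η y (i.removeNth e)) K y :=
      (dη y hy).continuousAlternatingMap_apply fun j => differentiableWithinAt_const _
    exact h1.hasFDerivWithinAt.const_mul _
  -- The divergence is d(g*β) on the standard basis, and d(g*β) = g*(dβ) up to the boundary of the
  -- cube.
  have hdiv : ∀ y ∈ K, ∑ i : Fin (n + 1), ((-1 : ℝ) ^ (i : ℕ) •
      fderivWithin ℝ (fun y => η y (i.removeNth e)) K y) (e i) =
        pullbackDensity (extDeriv β) g y := by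
    intro y hy
    have h1 := extDerivWithin_apply (dη y hy) (hr.1 y hy) e
    have h2 := extDerivWithin_pullback (t := univ) (s := K) (x := y)
      ((hβ.differentiable (by simp) (g y)).differentiableWithinAt) (hg y hy)
      minSmoothness_two_le_infty hr.1 (hr.2 hy) hy (mapsTo_univ _ _)
    rw [extDerivWithin_univ] at h2
    rw [h2] at h1
    refine Eq.trans ?_ h1.symm
    refine Finset.sum_congr rfl fun i _ => ?_
    simp
  have hcont : ContinuousOn (pullbackDensity (extDeriv β) g) K := by
    refine continuousOn_pullbackDensity ?_ hg
    exact (contDiff_clm_comp (ContinuousAlternatingMap.alternatizeUncurryFinCLM ℝ V ℝ)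
      (hβ.fderiv_right (m := ∞) (by simp))).continuous
  have hint : IntegrableOn (pullbackDensity (extDeriv β) g) K :=
    hcont.integrableOn_compact isCompact_Icc
  -- Only continuity is required on the boundary; in the interior the derivatives within the cube
  -- are genuine ones.
  have main := integral_divergence_of_hasFDerivAt_off_countable' (0 : Fin (n + 1) → ℝ) 1
    zero_le_one f
    (fun i y => (-1 : ℝ) ^ (i : ℕ) • fderivWithin ℝ (fun y => η y (i.removeNth e)) K y) ∅
    countable_empty (fun i y hy => (df i y hy).continuousWithinAt)
    (fun y hy i => by
      have hy' : y ∈ interior K := by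
        rw [hK, ← pi_univ_Icc, interior_pi_set finite_univ]
        intro j hj
        simp only [interior_Icc]
        exact hy.1 j hj
      exact (df i y (interior_subset hy')).hasFDerivAt (mem_interior_iff_mem_nhds.1 hy'))
    (hint.congr_fun (fun y hy => (hdiv y hy).symm) measurableSet_Icc)
  rw [setIntegral_congr_fun measurableSet_Icc (fun y hy => hdiv y hy)] at main
  rw [main]
  refine Finset.sum_congr rfl fun i _ => ?_
  have hface : ∀ ε ∈ Icc (0 : ℝ) 1, ∫ x in Icc (0 : Fin n → ℝ) 1, f i (i.insertNth ε x) =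
      (-1 : ℝ) ^ (i : ℕ) *
        ∫ y in Icc (0 : Fin n → ℝ) 1, pullbackDensity β (fun y => g (i.insertNth ε y)) y := by
    intro ε hε
    rw [← integral_const_mul]
    refine setIntegral_congr_fun measurableSet_Icc fun x hx => ?_
    simp only [pullbackDensity_face β hg i hε hx]
    rfl
  rw [mul_sub, ← hface 1 (by simp), ← hface 0 (by simp)]
  rfl

/-- Such a `g` factors through the projection killing the i-th coordinate, so its i-th partial
derivative vanishes and the form is evaluated with a zero entry. -/
theorem pullbackDensity_eq_zero (β : V → V [⋀^Fin n]→L[ℝ] ℝ) {g : (Fin n → ℝ) → V}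
    (hg : ContDiffOn ℝ ∞ g (Icc 0 1)) (i : Fin n)
    (hi : ∀ x y : Fin n → ℝ, (∀ j, j ≠ i → x j = y j) → g x = g y) {y : Fin n → ℝ}
    (hy : y ∈ Icc (0 : Fin n → ℝ) 1) : pullbackDensity β g y = 0 := by
  set p : (Fin n → ℝ) →L[ℝ] (Fin n → ℝ) := ContinuousLinearMap.pi fun j =>
    if j = i then 0 else ContinuousLinearMap.proj j with hp
  have hpa : ∀ x j, p x j = if j = i then 0 else x j := by
    intro x j
    by_cases h : j = i <;> simp [hp, h]
  have hm : MapsTo p (Icc (0 : Fin n → ℝ) 1) (Icc 0 1) := by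
    intro x hx
    refine ⟨fun j => ?_, fun j => ?_⟩ <;> rw [hpa] <;> split_ifs
    · exact le_rfl
    · exact hx.1 j
    · exact zero_le_one
    · exact hx.2 j
  have h1 : HasFDerivWithinAt (g ∘ p) ((fderivWithin ℝ g (Icc 0 1) (p y)).comp p) (Icc 0 1) y :=
    HasFDerivWithinAt.comp y ((hg _ (hm hy)).differentiableWithinAt (by simp)).hasFDerivWithinAt
      p.hasFDerivAt.hasFDerivWithinAt hm
  have h2 : g ∘ p = g := by
    funext x
    refine hi _ _ fun j hj => ?_
    rw [hpa, if_neg hj]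
  rw [h2] at h1
  refine (β (g y)).map_coord_zero i ?_
  rw [h1.fderivWithin ((isRegular_Icc n).1 y hy), ContinuousLinearMap.comp_apply]
  have : p (Pi.single i 1) = 0 := by
    funext j
    rw [hpa]
    split_ifs with h
    · rfl
    · simp [h]
  rw [this, map_zero]

end stokes

/-! ### Chains -/

section chains

variable {d n : ℕ}

theorem cubeIntegral_eq (α : Form d n) (σ : Cube d n) : cubeIntegral α σ =
    ∫ y in Icc (0 : Fin n → ℝ) 1, pullbackDensity α (cubeExtend σ.1) y := rfl

theorem cubeExtend_face (σ : Cube d (n + 1)) (i : Fin (n + 1)) (ε : unitInterval) :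
    cubeExtend (σ.face i ε).1 = fun y : Fin n → ℝ => cubeExtend σ.1 (i.insertNth (ε : ℝ) y) := by
  funext y
  simp only [cubeExtend, Cube.face]
  refine congrArg σ.1 (funext fun j => ?_)
  refine i.succAboveCases ?_ (fun j => ?_) j <;> simp

theorem cubeIntegral_extDeriv {β : Form d n} (hβ : ContDiff ℝ ∞ β) (σ : Cube d (n + 1)) :
    cubeIntegral (extDeriv β) σ = ∑ i : Fin (n + 1), (-1 : ℝ) ^ (i : ℕ) *
      (cubeIntegral β (σ.face i 1) - cubeIntegral β (σ.face i 0)) := by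
  simp only [cubeIntegral_eq, cubeExtend_face]
  exact integral_pullbackDensity_extDeriv hβ σ.2

/-- The integral of a form as a linear functional on chains. -/
def chainIntegralL (α : Form d n) : Chain d n →ₗ[ℝ] ℝ :=
  Finsupp.linearCombination ℝ (cubeIntegral α)

theorem chainIntegralL_apply (α : Form d n) (c : Chain d n) :
    chainIntegralL α c = chainIntegral α c := rfl

theorem chainIntegral_single (α : Form d n) (σ : Cube d n) :
    chainIntegralL α (Finsupp.single σ 1) = cubeIntegral α σ := by
  simp [chainIntegralL]

/-- Stokes' theorem for smooth singular cubical chains. -/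
theorem chainIntegral_extDeriv {β : Form d n} (hβ : ContDiff ℝ ∞ β) (b : Chain d (n + 1)) :
    chainIntegral (extDeriv β) b = chainIntegral β (boundary b) := by
  rw [← chainIntegralL_apply, ← chainIntegralL_apply, ← LinearMap.comp_apply]
  congr 1
  refine Finsupp.lhom_ext' fun σ => LinearMap.ext_ring ?_
  simp only [LinearMap.comp_apply, Finsupp.lsingle_apply, chainIntegral_single, boundary,
    Finsupp.linearCombination_single, one_smul, map_sum, map_smul, map_sub, smul_eq_mul,
    cubeIntegral_extDeriv hβ]

theorem chainIntegral_eq_zero_of_mem_degenerate (α : Form d n) {c : Chain d n}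
    (hc : c ∈ degenerate d n) : chainIntegral α c = 0 := by
  have : degenerate d n ≤ LinearMap.ker (chainIntegralL α) := by
    refine Submodule.span_le.2 ?_
    rintro _ ⟨σ, i, hi, rfl⟩
    rw [SetLike.mem_coe, LinearMap.mem_ker, chainIntegral_single, cubeIntegral_eq]
    refine setIntegral_eq_zero_of_forall_eq_zero fun y hy =>
      pullbackDensity_eq_zero α σ.2 i (fun x y hxy => ?_) hy
    exact hi _ _ fun j hj => by rw [hxy j hj]
  exact this hc

theorem chainIntegral_eq_of_sub_mem_degenerate (α : Form d n) {c c' : Chain d n}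
    (hc : c - c' ∈ degenerate d n) : chainIntegral α c = chainIntegral α c' := by
  have := chainIntegral_eq_zero_of_mem_degenerate α hc
  rw [← chainIntegralL_apply, map_sub, sub_eq_zero] at this
  exact this

variable {J : Set ℝ} {u Φ : ℝ → E d → E d}

/-- Taking faces is precomposition and transport is postcomposition, so they commute cube by cube.
-/
theorem boundary_transport (h : IsFlow J u Φ) {t : ℝ} (ht : t ∈ J) (c : Chain d (n + 1)) :
    boundary (transport h ht c) = transport h ht (boundary c) := by
  have : boundary ∘ₗ Finsupp.lmapDomain ℝ ℝ (Cube.map (n := n + 1) (Φ t) (h.contDiff ht)) =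
      Finsupp.lmapDomain ℝ ℝ (Cube.map (Φ t) (h.contDiff ht)) ∘ₗ boundary := by
    refine Finsupp.lhom_ext' fun σ => LinearMap.ext_ring ?_
    simp only [boundary, LinearMap.comp_apply, Finsupp.lsingle_apply, Finsupp.lmapDomain_apply,
      Finsupp.mapDomain_single, Finsupp.linearCombination_single, one_smul]
    simp only [← Finsupp.lmapDomain_apply ℝ ℝ, map_sum, map_smul, map_sub]
    simp only [Finsupp.lmapDomain_apply, Finsupp.mapDomain_single]
    rfl
  exact congrArg (fun L => L c) this

theorem transport_mem_degenerate (h : IsFlow J u Φ) {t : ℝ} (ht : t ∈ J) {c : Chain d n}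
    (hc : c ∈ degenerate d n) : transport h ht c ∈ degenerate d n := by
  have : degenerate d n ≤ (degenerate d n).comap
      (Finsupp.lmapDomain ℝ ℝ (Cube.map (Φ t) (h.contDiff ht))) := by
    refine Submodule.span_le.2 ?_
    rintro _ ⟨σ, i, hi, rfl⟩
    rw [SetLike.mem_coe, Submodule.mem_comap, Finsupp.lmapDomain_apply, Finsupp.mapDomain_single]
    exact Submodule.subset_span ⟨_, i, fun x y hxy => congrArg (Φ t) (hi x y hxy), rfl⟩
  exact this hc

/-- The integral of an exact form over a transported cycle vanishes. -/
theorem chainIntegral_extDeriv_transport {β : Form d n} (hβ : ContDiff ℝ ∞ β) (h : IsFlow J u Φ)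
    {t : ℝ} (ht : t ∈ J) {c : Chain d (n + 1)} (hc : IsCycle c) :
    chainIntegral (extDeriv β) (transport h ht c) = 0 := by
  rw [chainIntegral_extDeriv hβ, boundary_transport]
  exact chainIntegral_eq_zero_of_mem_degenerate β (transport_mem_degenerate h ht hc)

end chains

/-! ### Integrals over transported cubes -/

section transport

theorem hasDerivWithinAt_alternating_apply {ι V F : Type*} [Fintype ι] [DecidableEq ι]
    [NormedAddCommGroup V] [NormedSpace ℝ V] [NormedAddCommGroup F] [NormedSpace ℝ F] {J : Set ℝ}
    {a : ℝ → V [⋀^ι]→L[ℝ] F} {a' : V [⋀^ι]→L[ℝ] F} {w : ι → ℝ → V} {w' : ι → V} {t : ℝ}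
    (ha : HasDerivWithinAt a a' J t) (hw : ∀ i, HasDerivWithinAt (w i) (w' i) J t) :
    HasDerivWithinAt (fun s => a s (fun i => w i s))
      (a' (fun i => w i t) + ∑ i, a t (Function.update (fun i => w i t) i (w' i))) J t := by
  have h := (ha.hasFDerivWithinAt.continuousAlternatingMap_apply
    fun i => (hw i).hasFDerivWithinAt).hasDerivWithinAt
  refine h.congr_deriv ?_
  simp

theorem hasDerivWithinAt_clm_apply_const {V F : Type*} [NormedAddCommGroup V] [NormedSpace ℝ V]
    [NormedAddCommGroup F] [NormedSpace ℝ F] {J : Set ℝ} {L : ℝ → V →L[ℝ] F} {L' : V →L[ℝ] F}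
    {t : ℝ} (hL : HasDerivWithinAt L L' J t) (v : V) :
    HasDerivWithinAt (fun s => L s v) (L' v) J t :=
  (ContinuousLinearMap.apply ℝ F v).hasFDerivAt.comp_hasDerivWithinAt t hL

theorem integrable_uIcc_prod {n : ℕ} {K : Set (Fin n → ℝ)} (hK : IsCompact K) {a b : ℝ}
    {f : ℝ → (Fin n → ℝ) → ℝ}
    (hf : ContinuousOn (fun z : ℝ × (Fin n → ℝ) => f z.1 z.2) (uIcc a b ×ˢ K)) :
    Integrable (Function.uncurry f)
      ((volume.restrict (uIoc a b)).prod (volume.restrict K)) := by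
  rw [Measure.prod_restrict]
  have h := hf.integrableOn_compact (μ := volume.prod volume) (isCompact_uIcc.prod hK)
  exact h.mono_set (prod_mono uIoc_subset_uIcc le_rfl)

/-- A parametric fundamental theorem of calculus on an interval with one-sided derivatives at the
end points. -/
theorem setIntegral_sub_eq_intervalIntegral {n : ℕ} {J : Set ℝ} (hJ : J.OrdConnected)
    {K : Set (Fin n → ℝ)} (hK : IsCompact K) {a b : ℝ} (ha : a ∈ J) (hb : b ∈ J)
    {f f' : ℝ → (Fin n → ℝ) → ℝ}
    (hf : ContinuousOn (fun z : ℝ × (Fin n → ℝ) => f z.1 z.2) (J ×ˢ K))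
    (hf' : ContinuousOn (fun z : ℝ × (Fin n → ℝ) => f' z.1 z.2) (J ×ˢ K))
    (hd : ∀ s ∈ J, ∀ y ∈ K, HasDerivWithinAt (fun s => f s y) (f' s y) J s) :
    (∫ y in K, f b y) - ∫ y in K, f a y = ∫ s in a..b, ∫ y in K, f' s y := by
  have hsub : uIcc a b ⊆ J := hJ.uIcc_subset ha hb
  have hslice : ∀ s ∈ J, IntegrableOn (f s) K := fun s hs =>
    (hf.comp (f := fun y : Fin n → ℝ => (s, y)) (by fun_prop)
      fun y hy => mk_mem_prod hs hy).integrableOn_compact hK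
  rw [← integral_sub (hslice b hb) (hslice a ha),
    intervalIntegral_integral_swap
      (integrable_uIcc_prod hK (hf'.mono (prod_mono hsub le_rfl)))]
  refine setIntegral_congr_fun hK.measurableSet fun y hy => ?_
  refine (intervalIntegral.integral_eq_sub_of_hasDeriv_right (f := fun s => f s y)
    (f' := fun s => f' s y) (fun s hs => ?_) (fun s hs => ?_) ?_).symm
  · exact (hd s (hsub hs) y hy).continuousWithinAt.mono hsub
  -- Strictly between `a` and `b` the set `J` is a neighbourhood, so one-sided derivatives occur
  -- only at end points, where continuity is enough.
  · have hs' : J ∈ nhds s := Filter.mem_of_superset (Ioo_mem_nhds hs.1 hs.2)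
      (Ioo_subset_Icc_self.trans hsub)
    exact ((hd s (mem_of_mem_nhds hs') y hy).hasDerivAt hs').hasDerivWithinAt
  · refine ContinuousOn.intervalIntegrable ?_
    exact hf'.comp (f := fun s : ℝ => (s, y)) (by fun_prop) fun s hs => mk_mem_prod (hsub hs) hy

variable {d n : ℕ} {J : Set ℝ} {u Φ : ℝ → E d → E d} {g : (Fin n → ℝ) → E d}

theorem SmoothFamily.matDeriv {α : ℝ → Form d n} (hα : SmoothFamily J univ α)
    (hu : SmoothFamily J univ u) (hJ : IsRegular J) : SmoothFamily J univ (matDeriv J u α) := by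
  have h1 : SmoothFamily J univ (fun t x => totalDeriv J univ α t x (1, u t x)) := by
    have h2 : ContDiffOn ℝ ∞ (fun z : ℝ × E d => ((1 : ℝ), u z.1 z.2)) (J ×ˢ univ) :=
      contDiffOn_const.prodMk hu
    exact ContDiffOn.clm_apply (hα.smooth_totalDeriv hJ IsRegular.univ) h2
  have h3 : SmoothFamily J univ (fun t x =>
      (α t x).fderivCompContinuousLinearMap (ContinuousLinearMap.id ℝ (E d)) (fderiv ℝ (u t) x)) :=
    contDiffOn_clm₂ (ContinuousAlternatingMap.fderivCompContinuousLinearMapCLM (ι := Fin n) ℝ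
      (ContinuousLinearMap.id ℝ (E d))) hα (hu.fderiv_space hJ)
  have h4 : SmoothFamily J univ (fun t x => totalDeriv J univ α t x (1, u t x) +
      (α t x).fderivCompContinuousLinearMap (ContinuousLinearMap.id ℝ (E d))
        (fderiv ℝ (u t) x)) := ContDiffOn.add h1 h3
  exact h4.congr fun t ht x _ => matDeriv_eq hα hJ ht x

theorem IsFlow.smoothFamily_comp (hΦ : IsFlow J u Φ) (hg : ContDiffOn ℝ ∞ g (Icc 0 1)) :
    SmoothFamily J (Icc 0 1) (fun t y => Φ t (g y)) :=
  hΦ.smooth.comp (f := fun z : ℝ × (Fin n → ℝ) => (z.1, g z.2))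
    (contDiffOn_fst.prodMk (hg.comp contDiffOn_snd fun _ hz => hz.2))
    fun _ hz => ⟨hz.1, mem_univ _⟩

theorem continuousOn_transported_density {α : ℝ → Form d n} (hα : SmoothFamily J univ α)
    (hJ : IsRegular J) (hΦ : IsFlow J u Φ) (hg : ContDiffOn ℝ ∞ g (Icc 0 1)) :
    ContinuousOn (fun z : ℝ × (Fin n → ℝ) => pullbackDensity (α z.1) (fun y => Φ z.1 (g y)) z.2)
      (J ×ˢ Icc 0 1) := by
  have hΨ := hΦ.smoothFamily_comp hg
  have h1 : ContinuousOn (fun z : ℝ × (Fin n → ℝ) => α z.1 (Φ z.1 (g z.2))) (J ×ˢ Icc 0 1) :=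
    ContinuousOn.comp (f := fun z : ℝ × (Fin n → ℝ) => (z.1, Φ z.1 (g z.2)))
      (ContDiffOn.continuousOn hα)
      (continuousOn_fst.prodMk (ContDiffOn.continuousOn hΨ)) fun z hz => ⟨hz.1, mem_univ _⟩
  have h2 : ContinuousOn (fun z : ℝ × (Fin n → ℝ) =>
      fderivWithin ℝ (fun y => Φ z.1 (g y)) (Icc 0 1) z.2) (J ×ˢ Icc 0 1) :=
    ContDiffOn.continuousOn (hΨ.fderivWithin_space hJ (isRegular_Icc n))
  exact continuousOn_alternating_apply h1 fun i => h2.clm_apply continuousOn_const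

/-- This is d/dt (Φ_t*α) = Φ_t*((∂_t + L_u)α), read on a parametrized cube. The form contributes its
derivative along (1, u), and each tangent vector contributes one summand of the infinitesimal
pullback by Du. -/
theorem hasDerivWithinAt_transported_density {α : ℝ → Form d n} (hα : SmoothFamily J univ α)
    (hu : SmoothFamily J univ u) (hJ : IsRegular J) (hΦ : IsFlow J u Φ)
    (hg : ContDiffOn ℝ ∞ g (Icc 0 1)) {t : ℝ} (ht : t ∈ J) {y : Fin n → ℝ}
    (hy : y ∈ Icc (0 : Fin n → ℝ) 1) :
    HasDerivWithinAt (fun s => pullbackDensity (α s) (fun y => Φ s (g y)) y)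
      (pullbackDensity (matDeriv J u α t) (fun y => Φ t (g y)) y) J t := by
  have hΨ := hΦ.smoothFamily_comp hg
  have hr := isRegular_Icc n
  have h1 : HasDerivWithinAt (fun s => α s (Φ s (g y)))
      (totalDeriv J univ α t (Φ t (g y)) (1, u t (Φ t (g y)))) J t :=
    HasFDerivWithinAt.comp_hasDerivWithinAt (f := fun s => (s, Φ s (g y))) t
      (hα.hasFDerivWithinAt ht (mem_univ (Φ t (g y))))
      ((hasDerivWithinAt_id t J).prodMk (hΦ.velocity t ht (g y)))
      fun s hs => mk_mem_prod hs (mem_univ _)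
  -- The equation of variations: the space derivative of the flow evolves by Du, once time and space
  -- derivatives are exchanged.
  have h2 : fderivWithin ℝ (fun y => derivWithin (fun s => Φ s (g y)) J t) (Icc 0 1) y =
      (fderiv ℝ (u t) (Φ t (g y))).comp (fderivWithin ℝ (fun y => Φ t (g y)) (Icc 0 1) y) := by
    have h3 : ∀ y, derivWithin (fun s => Φ s (g y)) J t = u t (Φ t (g y)) := fun y =>
      (hΦ.velocity t ht (g y)).derivWithin (hJ.1 t ht)
    simp only [h3]
    have h4 : HasFDerivAt (u t) (fderiv ℝ (u t) (Φ t (g y))) (Φ t (g y)) :=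
      ((hu.contDiff ht).differentiable (by simp) _).hasFDerivAt
    have h5 : DifferentiableWithinAt ℝ (fun y => Φ t (g y)) (Icc 0 1) y :=
      ((hΨ.contDiffOn ht) y hy).differentiableWithinAt (by simp)
    exact (h4.comp_hasFDerivWithinAt y h5.hasFDerivWithinAt).fderivWithin (hr.1 y hy)
  have h3 := hΨ.hasDerivWithinAt_fderivWithin hJ hr ht hy
  rw [h2] at h3
  have h4 := hasDerivWithinAt_alternating_apply h1
    (w := fun i s => fderivWithin ℝ (fun y => Φ s (g y)) (Icc 0 1) y (Pi.single i 1))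
    fun i => hasDerivWithinAt_clm_apply_const h3 (Pi.single i 1)
  refine h4.congr_deriv ?_
  rw [pullbackDensity, matDeriv_eq hα hJ ht, ContinuousAlternatingMap.add_apply,
    ContinuousAlternatingMap.fderivCompContinuousLinearMap_apply]
  congr 1
  refine Finset.sum_congr rfl fun i _ => congrArg _ (funext fun j => ?_)
  rcases eq_or_ne j i with rfl | hj
  · simp
  · simp [Function.update_of_ne hj]

theorem chainIntegral_transport (γ : Form d n) (hΦ : IsFlow J u Φ) {t : ℝ} (ht : t ∈ J)
    (c : Chain d n) : chainIntegral γ (transport hΦ ht c) =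
      ∑ σ ∈ c.support, c σ * ∫ y in Icc (0 : Fin n → ℝ) 1,
        pullbackDensity γ (fun y => Φ t (cubeExtend σ.1 y)) y := by
  rw [chainIntegral, transport, Finsupp.sum_mapDomain_index (by simp) (by intros; ring)]
  rfl

theorem transport_zero (hΦ : IsFlow J u Φ) (h0 : (0 : ℝ) ∈ J) (c : Chain d n) :
    transport hΦ h0 c = c := by
  have : Cube.map (n := n) (Φ 0) (hΦ.contDiff h0) = id := by
    funext σ
    exact Subtype.ext (funext fun x => hΦ.initial _)
  rw [transport, this, Finsupp.mapDomain_id]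

/-- The integral of a form over a transported chain is constant if the integral of its material
derivative vanishes at all times. -/
theorem chainIntegral_transport_eq {α : ℝ → Form d n} (hα : SmoothFamily J univ α)
    (hu : SmoothFamily J univ u) (hJ : IsRegular J) (hJc : J.OrdConnected) (h0 : (0 : ℝ) ∈ J)
    (hΦ : IsFlow J u Φ) (c : Chain d n)
    (hc : ∀ (s : ℝ) (hs : s ∈ J), chainIntegral (matDeriv J u α s) (transport hΦ hs c) = 0)
    {t : ℝ} (ht : t ∈ J) : chainIntegral (α t) (transport hΦ ht c) = chainIntegral (α 0) c := by
  have hf' := hα.matDeriv hu hJ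
  have hsub : uIcc 0 t ⊆ J := hJc.uIcc_subset h0 ht
  conv_rhs => rw [← transport_zero hΦ h0 c]
  rw [← sub_eq_zero, chainIntegral_transport, chainIntegral_transport, ← Finset.sum_sub_distrib]
  have h1 : ∀ σ ∈ c.support, c σ * (∫ y in Icc (0 : Fin n → ℝ) 1,
      pullbackDensity (α t) (fun y => Φ t (cubeExtend σ.1 y)) y) -
      c σ * (∫ y in Icc (0 : Fin n → ℝ) 1,
      pullbackDensity (α 0) (fun y => Φ 0 (cubeExtend σ.1 y)) y) =
      ∫ s in (0 : ℝ)..t, c σ * ∫ y in Icc (0 : Fin n → ℝ) 1,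
        pullbackDensity (matDeriv J u α s) (fun y => Φ s (cubeExtend σ.1 y)) y := by
    intro σ _
    rw [← mul_sub, intervalIntegral.integral_const_mul]
    congr 1
    exact setIntegral_sub_eq_intervalIntegral hJc isCompact_Icc h0 ht
      (f := fun s => pullbackDensity (α s) (fun y => Φ s (cubeExtend σ.1 y)))
      (f' := fun s => pullbackDensity (matDeriv J u α s) (fun y => Φ s (cubeExtend σ.1 y)))
      (continuousOn_transported_density hα hJ hΦ σ.2)
      (continuousOn_transported_density hf' hJ hΦ σ.2)
      fun s hs y hy => hasDerivWithinAt_transported_density hα hu hJ hΦ σ.2 hs hy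
  -- The sum over cubes goes under the time integral because the hypothesis concerns only the whole
  -- chain.
  rw [Finset.sum_congr rfl h1, ← intervalIntegral.integral_finsetSum]
  · refine (intervalIntegral.integral_congr fun s hs => ?_).trans intervalIntegral.integral_zero
    rw [← chainIntegral_transport _ hΦ (hsub hs)]
    exact hc s (hsub hs)
  · intro σ _
    refine IntervalIntegrable.const_mul ?_ _
    rw [intervalIntegrable_iff]
    exact (integrable_uIcc_prod isCompact_Icc
      (f := fun s => pullbackDensity (matDeriv J u α s) (fun y => Φ s (cubeExtend σ.1 y)))
      ((continuousOn_transported_density hf' hJ hΦ σ.2).mono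
        (prod_mono hsub le_rfl))).integral_prod_left

end transport

/-! ### Forms carried by the flow up to a differential -/

section kelvin

variable {d : ℕ} {J : Set ℝ} {u : ℝ → E d → E d} {θ : ℝ → Form d 1} {q : ℝ → E d → ℝ}

/-- D commutes with d, and ddq = 0. -/
theorem matDeriv_extDeriv_eq_zero (hJ : IsRegular J) (hu : SmoothFamily J univ u)
    (hθ : SmoothFamily J univ θ) (hq : ∀ t ∈ J, ContDiff ℝ ∞ (q t))
    (hm : ∀ t ∈ J, ∀ x, matDeriv J u θ t x =
      -extDeriv (fun y => ContinuousAlternatingMap.constOfIsEmpty ℝ (E d) (Fin 0) (q t y)) x)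
    {t : ℝ} (ht : t ∈ J) (x : E d) : matDeriv J u (fun s => extDeriv (θ s)) t x = 0 := by
  have h1 : ContDiff ℝ ∞ (fun y =>
      ContinuousAlternatingMap.constOfIsEmpty ℝ (E d) (Fin 0) (q t y)) :=
    contDiff_clm_comp (ContinuousAlternatingMap.constOfIsEmptyLIE ℝ (E d) ℝ
      (Fin 0)).toContinuousLinearEquiv.toContinuousLinearMap (hq t ht)
  have h2 : matDeriv J u θ t = (-1 : ℝ) • extDeriv (fun y =>
      ContinuousAlternatingMap.constOfIsEmpty ℝ (E d) (Fin 0) (q t y)) := by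
    funext y
    rw [hm t ht, Pi.smul_apply, neg_one_smul]
  rw [← extDeriv_matDeriv hθ hu hJ ht, h2, extDeriv_smul,
    extDeriv_extDeriv_apply h1.contDiffAt minSmoothness_two_le_infty, smul_zero]

theorem matDeriv_dPow_eq_zero (hJ : IsRegular J) (hθ : SmoothFamily J univ θ)
    (hd : ∀ t ∈ J, ∀ x, matDeriv J u (fun s => extDeriv (θ s)) t x = 0) (k : ℕ)
    {t : ℝ} (ht : t ∈ J) (x : E d) : matDeriv J u (fun s => dPow (θ s) k) t x = 0 := by
  induction k with
  | zero =>
    have h1 : derivWithin (fun s => dPow (θ s) 0 x) J t = 0 :=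
      congrFun (derivWithin_const J (ContinuousAlternatingMap.constOfIsEmpty ℝ (E d) (Fin 0) 1)) t
    have h2 : fderiv ℝ (dPow (θ t) 0) x = 0 := (hasFDerivAt_const _ x).fderiv
    rw [matDeriv, lieDeriv, h1, h2]
    ext v
    simp
  | succ k ih =>
    have h := matDeriv_wedge (u := u) (Nat.mul_succ 2 k).symm (hθ.dPow hJ k) (hθ.extDeriv hJ) hJ
      ht x
    refine Eq.trans h ?_
    rw [ih, hd t ht, ← wedgeL_apply, ← wedgeL_apply, map_zero, map_zero]
    simp

/-- The formal part of the argument: Dθ = -dq is the only dynamical input, with no reference to the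
Euler equations. -/
theorem kelvinTheorems_of_matDeriv (hJ : IsRegular J) (hJc : J.OrdConnected) (h0 : (0 : ℝ) ∈ J)
    (hu : SmoothFamily J univ u) (hθ : SmoothFamily J univ θ) (hq : ∀ t ∈ J, ContDiff ℝ ∞ (q t))
    (hm : ∀ t ∈ J, ∀ x, matDeriv J u θ t x =
      -extDeriv (fun y => ContinuousAlternatingMap.constOfIsEmpty ℝ (E d) (Fin 0) (q t y)) x) :
    KelvinTheorems J u θ q := by
  have hd : ∀ t ∈ J, ∀ x, matDeriv J u (fun s => extDeriv (θ s)) t x = 0 := fun t ht x =>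
    matDeriv_extDeriv_eq_zero hJ hu hθ hq hm ht x
  have hH : ∀ k, ∀ t ∈ J, ∀ x, matDeriv J u (fun s => H (θ s) k) t x =
      -extDeriv (fun y => q t y • dPow (θ t) k y) x := by
    intro k t ht x
    have h := matDeriv_wedge (u := u) (Nat.add_comm 1 (2 * k)) hθ (hθ.dPow hJ k) hJ ht x
    refine Eq.trans h ?_
    rw [matDeriv_dPow_eq_zero hJ hθ hd k ht, hm t ht, extDeriv_constOfIsEmpty,
      extDeriv_smul_form (Nat.add_comm 1 (2 * k)) ((hq t ht).differentiable (by simp) x)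
        ((contDiff_dPow (hθ.contDiff ht) k).differentiable (by simp) x)
        (extDeriv_dPow (hθ.contDiff ht) k x)]
    simp only [← wedgeL_apply, map_neg, map_zero, add_zero]
    rfl
  have hG : ∀ k, ∀ t ∈ J, ContDiff ℝ ∞ (fun y => q t y • dPow (θ t) k y) := fun k t ht =>
    (hq t ht).smul (contDiff_dPow (hθ.contDiff ht) k)
  refine ⟨fun k t ht x => extDeriv_H (hθ.contDiff ht) k x, hm, hH, fun k t ht x => ?_,
    fun k t ht x => matDeriv_dPow_eq_zero hJ hθ hd (k + 1) ht x, fun k Φ hΦ c hc t ht => ?_,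
    fun k Φ hΦ c t ht b hb => ?_⟩
  · rw [hH (k + 1) t ht]
    congr 2
    funext y
    rw [extDeriv_H (hθ.contDiff ht) k y]
  -- The material derivative of H^k is exact at every time, so its integral over the transported
  -- cycle vanishes by Stokes.
  · refine chainIntegral_transport_eq (hθ.H hJ k) hu hJ hJc h0 hΦ c (fun s hs => ?_) ht
    have h1 : matDeriv J u (fun s => H (θ s) k) s =
        extDeriv ((-1 : ℝ) • fun y => q s y • dPow (θ s) k y) := by
      funext x
      rw [hH k s hs, extDeriv_smul, neg_one_smul]
    rw [h1]
    exact chainIntegral_extDeriv_transport ((hG k s hs).const_smul (-1 : ℝ)) hΦ hs hc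
  · rw [chainIntegral_extDeriv (contDiff_H (hθ.contDiff ht) k)]
    exact chainIntegral_eq_of_sub_mem_degenerate _ hb

end kelvin

/-! ### Euler flows -/

section euler

variable {d : ℕ} {J : Set ℝ} {A : E d →L[ℝ] E d} {u : ℝ → E d → E d} {P : ℝ → E d → ℝ}

theorem inner_gradient_eq (f : E d → ℝ) (x w : E d) : inner ℝ (∇ f x) w = fderiv ℝ f x w := by
  simp [gradient]

theorem IsEulerFlow.smooth_velocity (h : IsEulerFlow J A u P) : SmoothFamily J univ u := by
  rcases h with h | ⟨ρ, p, h⟩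
  · exact h.smooth_velocity
  · exact h.smooth_velocity

/-- Only differentiability of `h` is given, but its derivative f'(r)/r is smooth on the positive
axis. -/
theorem contDiffOn_enthalpy {f h : ℝ → ℝ} (hf : ContDiffOn ℝ ∞ f (Ioi 0))
    (hh : ∀ r > 0, HasDerivAt h (deriv f r / r) r) : ContDiffOn ℝ ∞ h (Ioi 0) := by
  rw [contDiffOn_infty_iff_deriv_of_isOpen isOpen_Ioi] at hf ⊢
  refine ⟨fun r hr => (hh r hr).differentiableAt.differentiableWithinAt, ?_⟩
  exact (hf.2.div contDiffOn_id fun r hr => (ne_of_gt hr)).congr fun r hr => (hh r hr).deriv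

theorem IsEulerFlow.contDiff_pressure (h : IsEulerFlow J A u P) {t : ℝ} (ht : t ∈ J) :
    ContDiff ℝ ∞ (P t) := by
  rcases h with h | ⟨ρ, p, h⟩
  · exact SmoothFamily.contDiff h.smooth_pressure ht
  · obtain ⟨f, k, hf, hk, hfk⟩ := h.state
    have h1 : P t = k ∘ ρ t := funext fun x => (hfk t ht x).2
    rw [h1]
    exact (contDiffOn_enthalpy hf hk).comp_contDiff (SmoothFamily.contDiff h.smooth_density ht)
      fun x => h.density_pos t ht x

/-- Here the two kinds of flow become one: in the barotropic case dp/ρ = (f'(ρ)/ρ) dρ = d(h(ρ)), and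
ρ > 0 can be divided out. -/
theorem IsEulerFlow.inner_acceleration (h : IsEulerFlow J A u P) {t : ℝ} (ht : t ∈ J) (x w : E d) :
    inner ℝ (acceleration J A u t x) w = -fderiv ℝ (P t) x w := by
  rcases h with h | ⟨ρ, p, h⟩
  · rw [h.momentum t ht, inner_neg_left, inner_gradient_eq]
  · obtain ⟨f, k, hf, hk, hfk⟩ := h.state
    have hpos := h.density_pos t ht x
    have hρ : HasFDerivAt (ρ t) (fderiv ℝ (ρ t) x) x :=
      ((SmoothFamily.contDiff h.smooth_density ht).differentiable (by simp) x).hasFDerivAt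
    have h1 : P t = k ∘ ρ t := funext fun x => (hfk t ht x).2
    have h2 : p t = f ∘ ρ t := funext fun x => (hfk t ht x).1
    have hf' : HasDerivAt f (deriv f (ρ t x)) (ρ t x) :=
      ((hf.contDiffAt (Ioi_mem_nhds hpos)).differentiableAt (by simp)).hasDerivAt
    have h3 : fderiv ℝ (P t) x w = deriv f (ρ t x) / ρ t x * fderiv ℝ (ρ t) x w := by
      rw [h1, ((hk _ hpos).comp_hasFDerivAt x hρ).fderiv]
      simp
    have h4 : fderiv ℝ (p t) x w = deriv f (ρ t x) * fderiv ℝ (ρ t) x w := by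
      rw [h2, (hf'.comp_hasFDerivAt x hρ).fderiv]
      simp
    have h5 := congrArg (fun v => inner ℝ v w) (h.momentum t ht x)
    simp only [real_inner_smul_left, inner_neg_left, inner_gradient_eq, h4] at h5
    rw [h3]
    field_simp
    linarith

theorem derivWithin_clm_comp {V F : Type*} [NormedAddCommGroup V] [NormedSpace ℝ V]
    [NormedAddCommGroup F] [NormedSpace ℝ F] (T : V →L[ℝ] F) {f : ℝ → V} {t : ℝ}
    (hJ : UniqueDiffWithinAt ℝ J t) (hf : DifferentiableWithinAt ℝ f J t) :
    derivWithin (fun s => T (f s)) J t = T (derivWithin f J t) :=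
  (T.hasFDerivAt.comp_hasDerivWithinAt t hf.hasDerivWithinAt).derivWithin hJ

/-- The `1`-form with given coefficients, as a continuous linear map. -/
def oneFormL (d : ℕ) : E d →L[ℝ] (E d [⋀^Fin 1]→L[ℝ] ℝ) :=
  LinearMap.toContinuousLinearMap
    { toFun := fun w => ContinuousAlternatingMap.ofSubsingleton ℝ (E d) ℝ (0 : Fin 1) (innerSL ℝ w)
      map_add' := fun w w' => by
        ext v
        simp
      map_smul' := fun c w => by
        ext v
        simp }

theorem oneFormL_apply_apply (w : E d) (v : Fin 1 → E d) : oneFormL d w v = inner ℝ w (v 0) := rfl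

theorem oneForm_add_eq (v w : E d → E d) (x : E d) :
    (oneForm v + oneForm w) x = oneFormL d (v x + w x) := by
  rw [map_add]
  rfl

/-- Pure kinematics: the frame velocity Ax is independent of time, so differentiating the
coefficients along the flow adds only Au, while the Lie derivative pairs u + Ax with Du. -/
theorem matDeriv_oneForm (hJ : IsRegular J) (hu : SmoothFamily J univ u) {t : ℝ} (ht : t ∈ J)
    (x : E d) (v : Fin 1 → E d) :
    matDeriv J u (fun t => oneForm (u t) + oneForm (fun x => A x)) t x v =
      inner ℝ (derivWithin (fun s => u s x) J t + fderiv ℝ (u t) x (u t x) + A (u t x)) (v 0) +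
        inner ℝ (u t x + A x) (fderiv ℝ (u t) x (v 0)) := by
  have h1 : (fun t => oneForm (u t) + oneForm (fun x => A x)) =
      fun t x => oneFormL d (u t x + A x) := by
    funext t x
    exact oneForm_add_eq _ _ x
  have hu1 : DifferentiableAt ℝ (u t) x := (hu.contDiff ht).differentiable (by simp) x
  have h2 : derivWithin (fun s => oneFormL d (u s x + A x)) J t =
      oneFormL d (derivWithin (fun s => u s x) J t) := by
    have h3 := (hu.hasDerivWithinAt_time ht (mem_univ x)).add_const (A x)
    rw [derivWithin_clm_comp _ (hJ.1 t ht) h3.differentiableWithinAt, derivWithin_add_const]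
  have h3 : fderiv ℝ (fun x => oneFormL d (u t x + A x)) x (u t x) =
      oneFormL d (fderiv ℝ (u t) x (u t x) + A (u t x)) := by
    rw [fderiv_clm_comp _ (f := fun x => u t x + A x) (hu1.add A.differentiableAt),
      fderiv_fun_add hu1 A.differentiableAt,
      A.fderiv]
    rfl
  rw [h1, matDeriv, lieDeriv, h2, h3]
  simp only [ContinuousAlternatingMap.add_apply, oneFormL_apply_apply,
    ContinuousAlternatingMap.fderivCompContinuousLinearMap_apply, Finset.univ_unique,
    Fin.default_eq_zero, Finset.sum_singleton, Function.update_self, inner_add_left]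
  ring

/-- Replacing the material acceleration by -∇P - 2Au - A²x leaves -∇P - Au - A²x after the kinematic
term Au. By skew-symmetry -⟨Au, v⟩ = ⟨u, Av⟩, which with ⟨Ax, Du v⟩ forms d⟨u, Ax⟩, and -⟨A²x, v⟩ =
⟨Ax, Av⟩ is the differential of |Ax|²/2. Finally ⟨u, Du v⟩ is that of |u|²/2. -/
theorem IsEulerFlow.matDeriv_oneForm (h : IsEulerFlow J A u P) (hJ : IsRegular J)
    (hA : ∀ x y, inner ℝ (A x) y = -inner ℝ x (A y)) {t : ℝ} (ht : t ∈ J) (x : E d) :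
    matDeriv J u (fun t => oneForm (u t) + oneForm (fun x => A x)) t x =
      -extDeriv (fun y => ContinuousAlternatingMap.constOfIsEmpty ℝ (E d) (Fin 0)
        ((P t y - inner ℝ (u t y) (A y) - ‖A y‖ ^ 2 / 2) - ‖u t y‖ ^ 2 / 2)) x := by
  ext v
  have hP : HasFDerivAt (P t) (fderiv ℝ (P t) x) x :=
    ((h.contDiff_pressure ht).differentiable (by simp) x).hasFDerivAt
  have hu : HasFDerivAt (u t) (fderiv ℝ (u t) x) x :=
    ((h.smooth_velocity.contDiff ht).differentiable (by simp) x).hasFDerivAt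
  have hq := (((hP.sub (hu.inner ℝ A.hasFDerivAt)).sub
    (A.hasFDerivAt.norm_sq.mul_const (1 / 2 : ℝ))).sub (hu.norm_sq.mul_const (1 / 2 : ℝ)))
  have hq' : fderiv ℝ (fun y => (P t y - inner ℝ (u t y) (A y) - ‖A y‖ ^ 2 / 2) -
      ‖u t y‖ ^ 2 / 2) x = _ := (hq.congr_of_eventuallyEq (.of_forall fun y => by
        simp [div_eq_mul_inv])).fderiv
  rw [extDeriv_constOfIsEmpty, ContinuousAlternatingMap.neg_apply,
    EulerForms.matDeriv_oneForm hJ h.smooth_velocity ht, hq']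
  have hacc := h.inner_acceleration ht x (v 0)
  have h1 := hA (u t x) (v 0)
  have h2 := hA (A x) (v 0)
  simp only [acceleration, inner_add_left, real_inner_smul_left] at hacc
  have h3 := real_inner_comm (A x) (fderiv ℝ (u t) x (v 0))
  simp [inner_add_left, fderivInnerCLM_apply]
  linarith

theorem kelvinTheorems_of_isEulerFlow (hJ : IsRegular J) (hJc : J.OrdConnected)
    (h0 : (0 : ℝ) ∈ J) (hA : ∀ x y, inner ℝ (A x) y = -inner ℝ x (A y))
    (h : IsEulerFlow J A u P) :
    KelvinTheorems J u (fun t => oneForm (u t) + oneForm (fun x => A x))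
      (fun t x => (P t x - inner ℝ (u t x) (A x) - ‖A x‖ ^ 2 / 2) - ‖u t x‖ ^ 2 / 2) := by
  have hu := h.smooth_velocity
  refine kelvinTheorems_of_matDeriv hJ hJc h0 hu ?_ (fun t ht => ?_) fun t ht x =>
    h.matDeriv_oneForm hJ hA ht x
  · have h1 : SmoothFamily J univ (fun t x => u t x + A x) :=
      ContDiffOn.add hu (A.contDiff.comp contDiff_snd).contDiffOn
    exact (h1.clm_comp (oneFormL d)).congr fun t _ x _ => oneForm_add_eq _ _ x
  · have h1 := h.contDiff_pressure ht
    have h2 := hu.contDiff ht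
    have h3 := A.contDiff (n := ∞)
    exact ((h1.sub (h2.inner ℝ h3)).sub ((h3.norm_sq ℝ).div_const 2)).sub
      ((h2.norm_sq ℝ).div_const 2)

end euler

/-! ### Nondegenerate time intervals and the conclusion. -/

theorem isRegular_of_ordConnected {J : Set ℝ} (hJ : J.OrdConnected) (hn : J.Nontrivial) :
    IsRegular J := by
  refine hJ.convex.isRegular ?_
  obtain ⟨a, ha, b, hb, hab⟩ := hn.exists_lt
  have : Ioo a b ⊆ interior J :=
    interior_maximal (Ioo_subset_Icc_self.trans (hJ.out ha hb)) isOpen_Ioo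
  exact (nonempty_Ioo.2 hab).mono this

end EulerForms

end

open EulerForms
theorem mainTheorem5 (d : ℕ) (J : Set ℝ) (hJ : J.OrdConnected) (hJ_nontrivial : J.Nontrivial)
    (h0 : (0 : ℝ) ∈ J) (u : ℝ → E d → E d) (P : ℝ → E d → ℝ) :
    (IsEulerFlow J 0 u P →
      KelvinTheorems J u (fun t => oneForm (u t)) (fun t x => P t x - ‖u t x‖ ^ 2 / 2)) ∧
    (∀ A : E d →L[ℝ] E d, (∀ x y, inner ℝ (A x) y = -inner ℝ x (A y)) →
      IsEulerFlow J A u P →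
        KelvinTheorems J u (fun t => oneForm (u t) + oneForm (fun x => A x))
          (fun t x => (P t x - inner ℝ (u t x) (A x) - ‖A x‖ ^ 2 / 2) - ‖u t x‖ ^ 2 / 2)) := by
  have hr := isRegular_of_ordConnected hJ hJ_nontrivial
  refine ⟨fun h => ?_, fun A hA h => kelvinTheorems_of_isEulerFlow hr hJ h0 hA h⟩
  -- The inertial frame is the case A = 0, in which the frame's 1-form and the corrections to the
  -- pressure vanish.
  have key := kelvinTheorems_of_isEulerFlow hr hJ h0 (A := 0) (by simp) h
  have h1 : oneForm (d := d) (fun _ => 0) = 0 := by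
    funext x
    ext v
    simp [oneForm]
  simpa [h1] using key
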